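/- Let $d\in\mathbb N$, let $\mathbb T^d=\mathbb R^d/\mathbb Z^d$ with its Lebesgue measure, let $q>1$, $r>\max\{d(q-1),1\}$, and let $p=q/(q-1)$ be the conjugate exponent of $q$. Let $H:\mathbb T^d\times\mathbb R^d\to\mathbb R$ be continuous, convex and differentiable in the second variable, with $D_pH$ (the gradient in the second variable) continuous on $\mathbb T^d\times\mathbb R^d$, and assume that for some $C>0$ $$\frac1{rC}|\xi|^r-C\le H(x,\xi)\le \frac Cr|\xi|^r+C\qquad\text{for all }x\in\mathbb T^d,\ \xi\in\mathbb R^d.$$ Let $f:\mathbb T^d\times(0,\infty)\to\mathbb R$ be continuous, strictly increasing in the second variable, and such that for some $C>0$ $$\frac1C m^{q-1}-C\le f(x,m)\le C m^{q-1}+C\qquad\text{for all }x\in\mathbb T^d,\ m\ge1.$$ Put $f(x,0):=\lim_{m\to0^+}f(x,m)\in[-\infty,\infty)$. A triple $(\lambda,\varphi,m)\in\mathbb R\times W^{1,pr}(\mathbb T^d)\times L^q(\mathbb T^d)$ is called a weak solution of the ergodic mean field game system $$\lambda+H(x,D\varphi)=f(x,m),\qquad -\operatorname{div}\bigl(m\,D_pH(x,D\varphi)\bigr)=0,\qquad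 m\ge0,\quad\int_{\mathbb T^d}m=1$$ if (i) $m\ge0$ a.e., $\int_{\mathbb T^d}m=1$ and $m\,D_pH(\cdot,D\varphi)\in L^1(\mathbb T^d)$; (ii) $\lambda+H(x,D\varphi(x))=f(x,m(x))$ for a.e. $x\in\{m>0\}$, and $\lambda+H(x,D\varphi(x))\le f(x,m(x))$ for a.e. $x\in\mathbb T^d$; (iii) $\operatorname{div}\bigl(m\,D_pH(\cdot,D\varphi)\bigr)=0$ in $\mathbb T^d$ in the sense of distributions. Then there exists at least one weak solution $(\lambda,\varphi,m)$. Moreover, the pair $(\lambda,m)$ is unique: if $(\lambda_1,\varphi_1,m_1)$ and $(\lambda_2,\varphi_2,m_2)$ are weak solutions, then $\lambda_1=\lambda_2$ and $m_1=m_2$ a.e. in $\mathbb T^d$. -/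

import Mathlib

open MeasureTheory Set Filter Topology

namespace ErgodicMFG

/-- The flat torus `𝕋^d = ℝ^d / ℤ^d`; its `volume` is the (normalized) Lebesgue measure. -/
abbrev Torus (d : ℕ) : Type := UnitAddTorus (Fin d)

instance isProbabilityMeasure_volume (d : ℕ) :
    IsProbabilityMeasure (volume : Measure (Torus d)) := by
  have h : IsProbabilityMeasure (volume : Measure UnitAddCircle) := ⟨UnitAddCircle.measure_univ⟩
  exact inferInstanceAs
    (IsProbabilityMeasure (Measure.pi fun _ : Fin d => (volume : Measure UnitAddCircle)))

/-- `ℝ^d` with the Euclidean norm and scalar product. -/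
abbrev Vec (d : ℕ) : Type := EuclideanSpace ℝ (Fin d)

/-- The quotient map `ℝ^d → 𝕋^d`. -/
def toTorus {d : ℕ} (v : Vec d) : Torus d := fun i => ((v i : ℝ) : UnitAddCircle)

/-- `ψ ∈ C^∞(𝕋^d)`: the periodic lift of `ψ` to `ℝ^d` is infinitely differentiable. -/
def SmoothOnTorus {d : ℕ} (ψ : Torus d → ℝ) : Prop :=
  ContDiff ℝ ((⊤ : ℕ∞) : WithTop ℕ∞) (fun v : Vec d => ψ (toTorus v))

/-- The classical gradient `Dψ(x)` of a function on the torus. -/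
noncomputable def torusGrad {d : ℕ} (ψ : Torus d → ℝ) (x : Torus d) : Vec d :=
  gradient (fun v : Vec d => ψ (x + toTorus v)) 0

/-- `φ ∈ W^{1,s}(𝕋^d)` and `g` is its weak gradient `Dφ` (for an exponent `s ≥ 1`). -/
structure HasSobolevGrad {d : ℕ} (s : ENNReal) (φ : Torus d → ℝ) (g : Torus d → Vec d) :
    Prop where
  memLp : MemLp φ s volume
  memLp_grad : MemLp g s volume
  integral_by_parts : ∀ ψ : Torus d → ℝ, SmoothOnTorus ψ → ∀ i : Fin d,
    ∫ x, φ x * torusGrad ψ x i = - ∫ x, g x i * ψ x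

/-- The vector field `w` (assumed integrable) satisfies `div w = 0` in the sense of
distributions on the torus. -/
def DivFree {d : ℕ} (w : Torus d → Vec d) : Prop :=
  ∀ ψ : Torus d → ℝ, SmoothOnTorus ψ → ∫ x, inner ℝ (w x) (torusGrad ψ x) = 0

/-- `D_p H(x, p)`, the gradient of the Hamiltonian in its second variable. -/
noncomputable def DpH {d : ℕ} (H : Torus d → Vec d → ℝ) (x : Torus d) (p : Vec d) : Vec d :=
  gradient (H x) p

/-- Conditions on the Hamiltonian, with growth exponent `r`. -/
structure HamiltonianCond {d : ℕ} (H : Torus d → Vec d → ℝ) (r : ℝ) : Prop where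
  continuous : Continuous (fun z : Torus d × Vec d => H z.1 z.2)
  convex : ∀ x, ConvexOn ℝ univ (H x)
  differentiable : ∀ x, Differentiable ℝ (H x)
  continuous_DpH : Continuous (fun z : Torus d × Vec d => DpH H z.1 z.2)
  growth : ∃ C : ℝ, 0 < C ∧ ∀ x p,
    1 / (r * C) * ‖p‖ ^ r - C ≤ H x p ∧ H x p ≤ C / r * ‖p‖ ^ r + C

/-- Conditions on the coupling, with growth exponent `q - 1`. Only the values `f x m` with
`m > 0` are constrained (and used). -/
structure CouplingCond {d : ℕ} (f : Torus d → ℝ → ℝ) (q : ℝ) : Prop where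
  continuousOn : ContinuousOn (fun z : Torus d × ℝ => f z.1 z.2) (univ ×ˢ Ioi (0 : ℝ))
  strictMonoOn : ∀ x, StrictMonoOn (f x) (Ioi (0 : ℝ))
  growth : ∃ C : ℝ, 0 < C ∧ ∀ x (m : ℝ), 1 ≤ m →
    1 / C * m ^ (q - 1) - C ≤ f x m ∧ f x m ≤ C * m ^ (q - 1) + C

/-- The coupling on `[0, ∞)`, with values in `[-∞, ∞)`: for `m > 0` it is `f x m`, and for
`m = 0` it is the limit of `f x s` as `s → 0⁺`, which is the infimum over `s > 0`
since `f x` is increasing; see `tendsto_couplingExt_zero`. -/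
noncomputable def couplingExt {d : ℕ} (f : Torus d → ℝ → ℝ) (x : Torus d) (m : ℝ) : EReal :=
  if 0 < m then (f x m : EReal) else ⨅ s : Ioi (0 : ℝ), (f x s : EReal)

theorem tendsto_couplingExt_zero {d : ℕ} {f : Torus d → ℝ → ℝ} {x : Torus d}
    (hf : StrictMonoOn (f x) (Ioi (0 : ℝ))) :
    Tendsto (fun s : ℝ => (f x s : EReal)) (𝓝[>] 0) (𝓝 (couplingExt f x 0)) := by
  have hm : MonotoneOn (fun s : ℝ => (f x s : EReal)) (Ioi (0 : ℝ)) := fun a ha b hb hab =>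
    EReal.coe_le_coe_iff.2 (hf.monotoneOn ha hb hab)
  have h := hm.tendsto_nhdsGT (OrderBot.bddBelow _)
  simpa [couplingExt, sInf_image'] using h

/-- `(lam, φ, m) ∈ ℝ × W^{1,pr}(𝕋^d) × L^q(𝕋^d)`, with `p = q / (q - 1)`, is a weak solution of
`lam + H(x, Dφ) = f(x, m)`, `-div (m D_pH(x, Dφ)) = 0`, `m ≥ 0`, `∫ m = 1`.
Here `g` is the weak gradient `Dφ`, which is unique up to a null set. -/
def IsWeakSolution {d : ℕ} (H : Torus d → Vec d → ℝ) (f : Torus d → ℝ → ℝ) (q r : ℝ)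
    (lam : ℝ) (φ m : Torus d → ℝ) : Prop :=
  ∃ g : Torus d → Vec d,
    HasSobolevGrad (ENNReal.ofReal (Real.conjExponent q * r)) φ g ∧
    MemLp m (ENNReal.ofReal q) volume ∧
    (∀ᵐ x, 0 ≤ m x) ∧ ∫ x, m x = 1 ∧
    Integrable (fun x => m x • DpH H x (g x)) volume ∧
    (∀ᵐ x, 0 < m x → lam + H x (g x) = f x (m x)) ∧
    (∀ᵐ x, ((lam + H x (g x) : ℝ) : EReal) ≤ couplingExt f x (m x)) ∧
    DivFree (fun x => m x • DpH H x (g x))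

end ErgodicMFG

/-! The density can be eliminated. Write `couplingInv f x` for the inverse of `f x`, extended by `0`
below its range. For `m ≥ 0`, the two relations linking `lam + H x Dφ` and `m` say exactly that `m =
couplingInv f x (lam + H x Dφ)`. If `couplingPrim f x` denotes a primitive of this inverse, it is
convex and nondecreasing, and the remaining two equations, unit mass and zero divergence, are the
Euler-Lagrange equations in `lam` and `φ` of the convex energy `∫ couplingPrim f x (lam + H x Dφ) -
lam`.

Existence. With `s = pr`, the growth assumptions make the energy bound `|lam|` and the `L^s` norm of
`Dφ` (`exists_integral_norm_rpow_le`), while the derivative of the integrand grows only like the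
power `s - 1` of the gradient (`exists_abs_energyDeriv_le`). The energy is minimized over smooth
functions. Strong rather than weak convergence of the gradients comes from a special minimizing
sequence, which almost minimizes `∫ ‖Dψ‖ ^ s` among the almost minimizers (`exists_minimizing_seq`):
midpoints are again almost minimizers, so the convexity gap of that integral tends to zero, and
uniform convexity (`exists_norm_sub_rpow_le`) makes the gradients Cauchy in `L^s`. A subsequence
converges a.e., and the first-order inequality, which convexity provides without differentiating
under the integral, passes to the limit by Fatou's lemma (`exists_critical_point`). It holds in
every direction and its opposite, hence is an equality.

Uniqueness. The flux lies in the dual of `L^s`, so zero divergence extends from smooth test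
functions to weak gradients (`integral_inner_weakGrad_eq_zero`). Testing the flux of each solution
against both gradients and using the convexity of `H` gives `l₂ - l₁ ≤ ∫ M₁ (a₂ - a₁)` and its
mirror image, where `aᵢ = lᵢ + H x Dφᵢ` and `Mᵢ = couplingInv f x aᵢ`. Added up, they contradict the
monotonicity of the inverse unless `M₁ = M₂` a.e.; then the right-hand sides vanish and `l₁ = l₂`.
-/

namespace ErgodicMFG

/-! ### Calculus on the torus through periodic lifts -/

section TorusCalculus

variable {d : ℕ}

theorem toTorus_add (v w : Vec d) : toTorus (v + w) = toTorus v + toTorus w := by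
  funext i; simp [toTorus]

@[simp]
theorem toTorus_zero : toTorus (0 : Vec d) = 0 := by
  funext i; simp [toTorus]

theorem continuous_toTorus : Continuous (toTorus (d := d)) := by
  refine continuous_pi fun i => ?_
  exact (AddCircle.continuous_mk' 1).comp (by fun_prop)

/-- The representative is taken in the cube `[0,1)^d`. Its norm bound becomes the constant in the
Poincaré inequality. -/
theorem exists_toTorus_eq (h : Torus d) : ∃ v : Vec d, toTorus v = h ∧ ‖v‖ ≤ √d := by
  choose u hu using fun i => AddCircle.eq_coe_Ico (p := (1 : ℝ)) (h i)
  refine ⟨WithLp.toLp 2 u, ?_, ?_⟩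
  · funext i; exact (hu i).2
  · rw [EuclideanSpace.norm_eq]
    apply Real.sqrt_le_sqrt
    calc ∑ i, ‖(WithLp.toLp 2 u : Vec d) i‖ ^ 2 ≤ ∑ _i : Fin d, (1 : ℝ) := by
          refine Finset.sum_le_sum fun i _ => ?_
          have h1 := (hu i).1
          rw [mem_Ico] at h1
          have : ‖(WithLp.toLp 2 u : Vec d) i‖ = u i := by
            simp [abs_of_nonneg h1.1]
          rw [this]
          nlinarith [h1.1, h1.2]
      _ = d := by simp

theorem toTorus_surjective : Function.Surjective (toTorus (d := d)) := fun h =>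
  (exists_toTorus_eq h).imp fun _ h => h.1

theorem isOpenMap_toTorus : IsOpenMap (toTorus (d := d)) := by
  have h1 : IsOpenMap (Pi.map fun (_ : Fin d) (t : ℝ) => (t : UnitAddCircle)) :=
    IsOpenMap.piMap (fun _ => QuotientAddGroup.isOpenMap_coe)
      (Eventually.of_forall fun _ => QuotientAddGroup.mk_surjective)
  exact h1.comp (EuclideanSpace.equiv (Fin d) ℝ).toHomeomorph.isOpenMap

/-- An open continuous surjection is a quotient map, so continuity on the torus can be tested on the
periodic lift. -/
theorem continuous_of_comp_toTorus {X : Type*} [TopologicalSpace X] {F : Torus d → X}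
    (h : Continuous fun v : Vec d => F (toTorus v)) : Continuous F :=
  (isOpenMap_toTorus.isQuotientMap continuous_toTorus toTorus_surjective).continuous_iff.2 h

variable {ψ η : Torus d → ℝ}

theorem SmoothOnTorus.translate (hψ : SmoothOnTorus ψ) (x : Torus d) :
    ContDiff ℝ ((⊤ : ℕ∞) : WithTop ℕ∞) (fun v : Vec d => ψ (x + toTorus v)) := by
  obtain ⟨w, rfl⟩ := toTorus_surjective x
  simp_rw [← toTorus_add]
  exact ContDiff.comp (g := fun v : Vec d => ψ (toTorus v)) hψ (contDiff_const.add contDiff_id)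

theorem SmoothOnTorus.hasGradientAt (hψ : SmoothOnTorus ψ) (x : Torus d) (v : Vec d) :
    HasGradientAt (fun u : Vec d => ψ (x + toTorus u)) (torusGrad ψ (x + toTorus v)) v := by
  have h0 : HasGradientAt (fun u : Vec d => ψ (x + toTorus v + toTorus u))
      (torusGrad ψ (x + toTorus v)) (v - v) := by
    rw [sub_self]
    exact (((hψ.translate (x + toTorus v)).differentiable (by simp)) 0).hasGradientAt
  rw [hasGradientAt_iff_hasFDerivAt] at h0 ⊢
  have h2 := HasFDerivAt.comp (f := fun u : Vec d => u - v) v h0 ((hasFDerivAt_id v).sub_const v)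
  refine (h2.congr_of_eventuallyEq (Eventually.of_forall fun u => ?_))
  simp only [Function.comp, add_assoc, ← toTorus_add, add_sub_cancel]

theorem SmoothOnTorus.torusGrad_eq (hψ : SmoothOnTorus ψ) {x : Torus d} {g : Vec d}
    (h : HasGradientAt (fun u : Vec d => ψ (x + toTorus u)) g 0) : torusGrad ψ x = g := by
  have h1 := hψ.hasGradientAt x 0
  rw [toTorus_zero, add_zero] at h1
  exact h1.unique h

theorem SmoothOnTorus.hasGradientAt_zero (hψ : SmoothOnTorus ψ) (x : Torus d) :
    HasGradientAt (fun u : Vec d => ψ (x + toTorus u)) (torusGrad ψ x) 0 := by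
  simpa using hψ.hasGradientAt x 0

theorem SmoothOnTorus.continuous (hψ : SmoothOnTorus ψ) : Continuous ψ :=
  continuous_of_comp_toTorus (ContDiff.continuous hψ)

theorem SmoothOnTorus.continuous_torusGrad (hψ : SmoothOnTorus ψ) :
    Continuous (torusGrad ψ) := by
  refine continuous_of_comp_toTorus ?_
  have h1 : (fun v : Vec d => torusGrad ψ (toTorus v)) =
      fun v => (InnerProductSpace.toDual ℝ (Vec d)).symm
        (fderiv ℝ (fun u : Vec d => ψ (toTorus u)) v) := by
    funext v
    have := (hψ.hasGradientAt 0 v).gradient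
    simp only [zero_add] at this
    rw [← this]; rfl
  rw [h1]
  exact (LinearIsometryEquiv.continuous _).comp (ContDiff.continuous_fderiv hψ (by simp))

theorem SmoothOnTorus.const (c : ℝ) : SmoothOnTorus (fun _ : Torus d => c) := contDiff_const

theorem SmoothOnTorus.add (hψ : SmoothOnTorus ψ) (hη : SmoothOnTorus η) :
    SmoothOnTorus (fun x => ψ x + η x) := ContDiff.add hψ hη

theorem SmoothOnTorus.const_mul (hψ : SmoothOnTorus ψ) (c : ℝ) :
    SmoothOnTorus (fun x => c * ψ x) := ContDiff.mul contDiff_const hψ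

theorem SmoothOnTorus.mul (hψ : SmoothOnTorus ψ) (hη : SmoothOnTorus η) :
    SmoothOnTorus (fun x => ψ x * η x) := ContDiff.mul hψ hη

theorem torusGrad_add (hψ : SmoothOnTorus ψ) (hη : SmoothOnTorus η) (x : Torus d) :
    torusGrad (fun x => ψ x + η x) x = torusGrad ψ x + torusGrad η x := by
  refine (hψ.add hη).torusGrad_eq ?_
  have h1 := hψ.hasGradientAt_zero x
  have h2 := hη.hasGradientAt_zero x
  rw [hasGradientAt_iff_hasFDerivAt] at h1 h2 ⊢
  rw [map_add]
  exact h1.add h2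

theorem torusGrad_const_mul (hψ : SmoothOnTorus ψ) (c : ℝ) (x : Torus d) :
    torusGrad (fun x => c * ψ x) x = c • torusGrad ψ x := by
  refine (hψ.const_mul c).torusGrad_eq ?_
  have h1 := hψ.hasGradientAt_zero x
  rw [hasGradientAt_iff_hasFDerivAt] at h1 ⊢
  rw [map_smulₛₗ]
  exact h1.const_mul c

theorem torusGrad_mul (hψ : SmoothOnTorus ψ) (hη : SmoothOnTorus η) (x : Torus d) :
    torusGrad (fun x => ψ x * η x) x = ψ x • torusGrad η x + η x • torusGrad ψ x := by
  refine (hψ.mul hη).torusGrad_eq ?_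
  have h1 := hψ.hasGradientAt_zero x
  have h2 := hη.hasGradientAt_zero x
  rw [hasGradientAt_iff_hasFDerivAt] at h1 h2 ⊢
  rw [map_add, map_smulₛₗ, map_smulₛₗ]
  have h3 := h1.mul h2
  simp only [toTorus_zero, add_zero] at h3
  exact h3

theorem torusGrad_const (c : ℝ) (x : Torus d) : torusGrad (fun _ => c) x = 0 :=
  gradient_const 0 c

theorem SmoothOnTorus.hasDerivAt_line (hψ : SmoothOnTorus ψ) (x : Torus d) (v : Vec d) (t : ℝ) :
    HasDerivAt (fun t : ℝ => ψ (x + toTorus (t • v)))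
      (inner ℝ (torusGrad ψ (x + toTorus (t • v))) v) t := by
  have h1 := (hasGradientAt_iff_hasFDerivAt.1 (hψ.hasGradientAt x (t • v)))
  have h2 : HasDerivAt (fun t : ℝ => t • v) v t := by
    simpa using (hasDerivAt_id t).smul_const v
  have h3 := h1.comp_hasDerivAt t h2
  rw [InnerProductSpace.toDual_apply_apply] at h3
  exact h3

theorem SmoothOnTorus.sub_eq_integral (hψ : SmoothOnTorus ψ) (x : Torus d) (v : Vec d) :
    ψ (x + toTorus v) - ψ x =
      ∫ t in (0 : ℝ)..1, inner ℝ (torusGrad ψ (x + toTorus (t • v))) v := by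
  have hc : Continuous fun t : ℝ => inner ℝ (torusGrad ψ (x + toTorus (t • v))) v := by
    refine Continuous.inner (hψ.continuous_torusGrad.comp ?_) continuous_const
    exact continuous_const.add (continuous_toTorus.comp (by fun_prop))
  rw [intervalIntegral.integral_eq_sub_of_hasDerivAt (fun t _ => hψ.hasDerivAt_line x v t)
    (hc.intervalIntegrable _ _)]
  simp

theorem integrable_of_continuous {X E : Type*} [TopologicalSpace X] [CompactSpace X]
    [MeasurableSpace X] [OpensMeasurableSpace X] [NormedAddCommGroup E]
    [SecondCountableTopologyEither X E] {μ : Measure X} [IsFiniteMeasure μ]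
    {F : X → E} (hF : Continuous F) : Integrable F μ :=
  hF.integrable_of_hasCompactSupport (HasCompactSupport.of_compactSpace F)

theorem integrable_prod_uIoc_of_continuous {E : Type*} [NormedAddCommGroup E]
    {F : ℝ → Torus d → E} (hF : Continuous (Function.uncurry F)) :
    Integrable (Function.uncurry F) ((volume.restrict (uIoc (0 : ℝ) 1)).prod volume) := by
  have h1 : IntegrableOn (Function.uncurry F) (Icc (0 : ℝ) 1 ×ˢ univ)
      ((volume : Measure ℝ).prod (volume : Measure (Torus d))) :=
    hF.continuousOn.integrableOn_compact (isCompact_Icc.prod isCompact_univ)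
  have h2 := h1.mono_set (prod_mono_left (t := univ) (Ioc_subset_Icc_self (a := (0 : ℝ)) (b := 1)))
  rwa [IntegrableOn, ← Measure.prod_restrict, Measure.restrict_univ,
    ← uIoc_of_le zero_le_one] at h2

/-- Translation invariance, used twice. The increment of `ψ` along `v` has zero integral; written as
an integral over the segment and exchanged by Fubini, it is an average over `t` of integrals that do
not depend on `t`. -/
theorem integral_inner_torusGrad_eq_zero (hψ : SmoothOnTorus ψ) (v : Vec d) :
    ∫ x, inner ℝ (torusGrad ψ x) v = 0 := by
  have hc : Continuous (Function.uncurry fun (t : ℝ) (x : Torus d) =>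
      inner ℝ (torusGrad ψ (x + toTorus (t • v))) v) := by
    refine Continuous.inner (hψ.continuous_torusGrad.comp ?_) continuous_const
    exact continuous_snd.add (continuous_toTorus.comp (by fun_prop))
  have h1 : ∫ x, (ψ (x + toTorus v) - ψ x) = 0 := by
    rw [integral_sub, integral_add_right_eq_self (fun x => ψ x), sub_self]
    · exact integrable_of_continuous (hψ.continuous.comp (by fun_prop))
    · exact integrable_of_continuous hψ.continuous
  simp_rw [hψ.sub_eq_integral] at h1
  rw [← intervalIntegral_integral_swap (integrable_prod_uIoc_of_continuous hc)] at h1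
  have h2 : ∀ t : ℝ, ∫ x, inner ℝ (torusGrad ψ (x + toTorus (t • v))) v =
      ∫ x, inner ℝ (torusGrad ψ x) v := fun t =>
    integral_add_right_eq_self (fun x : Torus d => inner ℝ (torusGrad ψ x) v) (toTorus (t • v))
  simpa [h2] using h1

theorem integral_mul_torusGrad (hψ : SmoothOnTorus ψ) (hη : SmoothOnTorus η) (i : Fin d) :
    ∫ x, ψ x * torusGrad η x i = - ∫ x, torusGrad ψ x i * η x := by
  have h := integral_inner_torusGrad_eq_zero (hψ.mul hη) (EuclideanSpace.single i 1)
  have hi : Continuous fun v : Vec d => v i := by fun_prop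
  simp_rw [torusGrad_mul hψ hη, EuclideanSpace.inner_single_right] at h
  simp only [PiLp.add_apply, PiLp.smul_apply, smul_eq_mul, one_mul,
    conj_trivial] at h
  rw [integral_add] at h
  · rw [eq_neg_of_add_eq_zero_left h]
    simp_rw [mul_comm]
  · exact integrable_of_continuous
      (hψ.continuous.mul (hi.comp hη.continuous_torusGrad))
  · exact integrable_of_continuous
      (hη.continuous.mul (hi.comp hψ.continuous_torusGrad))

end TorusCalculus

/-! ### Poincaré inequality by averaging over translations -/

section Poincare

theorem abs_integral_rpow_le {Ω : Type*} [MeasurableSpace Ω] {μ : Measure Ω}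
    [IsProbabilityMeasure μ] {s : ℝ} (hs : 1 ≤ s) {F : Ω → ℝ} (hF : Integrable F μ)
    (hFs : Integrable (fun x => |F x| ^ s) μ) : |∫ x, F x ∂μ| ^ s ≤ ∫ x, |F x| ^ s ∂μ := by
  have h1 : |∫ x, F x ∂μ| ≤ ∫ x, |F x| ∂μ := abs_integral_le_integral_abs
  have h2 := (convexOn_rpow hs).map_integral_le (μ := μ) (f := fun x => |F x|)
    (continuousOn_id.rpow_const fun x _ => Or.inr (by linarith)) isClosed_Ici
    (Eventually.of_forall fun x => abs_nonneg (F x)) hF.abs hFs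
  exact (Real.rpow_le_rpow (abs_nonneg _) h1 (by linarith)).trans h2

variable {d : ℕ} {ψ : Torus d → ℝ}

theorem continuous_abs_rpow {X : Type*} [TopologicalSpace X] {F : X → ℝ} (hF : Continuous F)
    {s : ℝ} (hs : 1 ≤ s) : Continuous fun x => |F x| ^ s :=
  hF.abs.rpow_const fun _ => Or.inr (by linarith)

/-- The increment is the mean of a directional derivative over a segment: apply Jensen, then Fubini
and translation invariance. -/
theorem integral_abs_translate_sub_rpow_le (hψ : SmoothOnTorus ψ) {s : ℝ} (hs : 1 ≤ s)
    (v : Vec d) : ∫ x, |ψ (x + toTorus v) - ψ x| ^ s ≤ ‖v‖ ^ s * ∫ x, ‖torusGrad ψ x‖ ^ s := by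
  have hprob : IsProbabilityMeasure (volume.restrict (Ioc (0 : ℝ) 1)) := ⟨by simp⟩
  have hs0 : 0 ≤ s := by linarith
  have harg : Continuous fun z : ℝ × Torus d => z.2 + toTorus (z.1 • v) :=
    continuous_snd.add (continuous_toTorus.comp (by fun_prop))
  have hc : Continuous fun z : ℝ × Torus d =>
      inner ℝ (torusGrad ψ (z.2 + toTorus (z.1 • v))) v :=
    (hψ.continuous_torusGrad.comp harg).inner continuous_const
  have hc2 : Continuous fun z : ℝ × Torus d =>
      ‖v‖ ^ s * ‖torusGrad ψ (z.2 + toTorus (z.1 • v))‖ ^ s :=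
    continuous_const.mul ((hψ.continuous_torusGrad.comp harg).norm.rpow_const
      fun _ => Or.inr hs0)
  have hslice : ∀ x : Torus d, Continuous fun t : ℝ => (t, x) := fun x => by fun_prop
  have key : ∀ x, |ψ (x + toTorus v) - ψ x| ^ s ≤
      ∫ t in (0 : ℝ)..1, ‖v‖ ^ s * ‖torusGrad ψ (x + toTorus (t • v))‖ ^ s := by
    intro x
    rw [hψ.sub_eq_integral, intervalIntegral.integral_of_le zero_le_one,
      intervalIntegral.integral_of_le zero_le_one]
    have hi {F : ℝ → ℝ} (hF : Continuous F) : Integrable F (volume.restrict (Ioc (0 : ℝ) 1)) :=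
      (hF.integrableOn_Icc).mono_set Ioc_subset_Icc_self
    have hcx : Continuous fun t : ℝ => inner ℝ (torusGrad ψ (x + toTorus (t • v))) v :=
by
      have := hc.comp (hslice x)
      simpa only [Function.comp_def] using this
    have hcxs := continuous_abs_rpow hcx hs
    have hcx2 : Continuous fun t : ℝ => ‖v‖ ^ s * ‖torusGrad ψ (x + toTorus (t • v))‖ ^ s :=
by
      have := hc2.comp (hslice x)
      simpa only [Function.comp_def] using this
    refine (abs_integral_rpow_le hs (hi hcx) (hi hcxs)).trans ?_
    refine integral_mono (hi hcxs) (hi hcx2) fun t => ?_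
    have h1 : |inner ℝ (torusGrad ψ (x + toTorus (t • v))) v| ≤
        ‖v‖ * ‖torusGrad ψ (x + toTorus (t • v))‖ := by
      rw [mul_comm]; exact abs_real_inner_le_norm _ _
    have h2 := Real.rpow_le_rpow (abs_nonneg _) h1 hs0
    rwa [Real.mul_rpow (norm_nonneg _) (norm_nonneg _)] at h2
  have hint := integrable_prod_uIoc_of_continuous (d := d) (F := fun t x =>
    ‖v‖ ^ s * ‖torusGrad ψ (x + toTorus (t • v))‖ ^ s) hc2
  calc ∫ x, |ψ (x + toTorus v) - ψ x| ^ s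
      ≤ ∫ x, ∫ t in (0 : ℝ)..1, ‖v‖ ^ s * ‖torusGrad ψ (x + toTorus (t • v))‖ ^ s := by
        refine integral_mono (integrable_of_continuous (continuous_abs_rpow
          ((hψ.continuous.comp (by fun_prop)).sub hψ.continuous) hs)) ?_ key
        refine integrable_of_continuous ?_
        exact intervalIntegral.continuous_parametric_intervalIntegral_of_continuous'
          (f := fun x t => ‖v‖ ^ s * ‖torusGrad ψ (x + toTorus (t • v))‖ ^ s)
          (by simpa only [Function.comp_def, Function.uncurry_def, Prod.fst_swap, Prod.snd_swap]
            using hc2.comp continuous_swap) 0 1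
    _ = ‖v‖ ^ s * ∫ x, ‖torusGrad ψ x‖ ^ s := by
        rw [← intervalIntegral_integral_swap hint]
        have h1 : ∀ t : ℝ, ∫ x, ‖v‖ ^ s * ‖torusGrad ψ (x + toTorus (t • v))‖ ^ s =
            ‖v‖ ^ s * ∫ x, ‖torusGrad ψ x‖ ^ s := fun t => by
          rw [integral_const_mul, integral_add_right_eq_self
            (fun x : Torus d => ‖torusGrad ψ x‖ ^ s) (toTorus (t • v))]
        simp only [h1, intervalIntegral.integral_const, sub_zero, one_smul]

/-- **Poincaré inequality** on the torus, for smooth functions. -/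
theorem poincare (hψ : SmoothOnTorus ψ) {s : ℝ} (hs : 1 ≤ s) :
    ∫ x, |ψ x - ∫ y, ψ y| ^ s ≤ √d ^ s * ∫ x, ‖torusGrad ψ x‖ ^ s := by
  have hs0 : 0 ≤ s := by linarith
  have hψc := hψ.continuous
  have hc : Continuous fun z : Torus d × Torus d => ψ (z.1 + z.2) - ψ z.1 := by fun_prop
  have hcs := continuous_abs_rpow hc hs
  have hgrad : Continuous fun x => ‖torusGrad ψ x‖ ^ s :=
    hψ.continuous_torusGrad.norm.rpow_const fun _ => Or.inr hs0
  -- The deviation from the mean is an average of translation increments, because `y ↦ x + y`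
  -- preserves the measure; Jensen then moves the power inside.
  have key : ∀ x, |ψ x - ∫ y, ψ y| ^ s ≤ ∫ y, |ψ (x + y) - ψ x| ^ s := by
    intro x
    have h1 : |ψ x - ∫ y, ψ y| = |∫ y, (ψ (x + y) - ψ x)| := by
      rw [integral_sub (integrable_of_continuous (by fun_prop)) (integrable_const _),
        integral_add_left_eq_self (fun y => ψ y) x, abs_sub_comm]
      simp
    rw [h1]
    have hx : Continuous fun y : Torus d => ψ (x + y) - ψ x := by fun_prop
    exact abs_integral_rpow_le hs (integrable_of_continuous hx)
      (integrable_of_continuous (continuous_abs_rpow hx hs))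
  have hint : Integrable (fun z : Torus d × Torus d => |ψ (z.1 + z.2) - ψ z.1| ^ s)
      (volume.prod volume) := integrable_of_continuous hcs
  calc ∫ x, |ψ x - ∫ y, ψ y| ^ s ≤ ∫ x, ∫ y, |ψ (x + y) - ψ x| ^ s :=
        integral_mono (integrable_of_continuous (continuous_abs_rpow (by fun_prop) hs))
          hint.integral_prod_left key
    _ = ∫ y, ∫ x, |ψ (x + y) - ψ x| ^ s := integral_integral_swap hint
    _ ≤ ∫ _y : Torus d, √d ^ s * ∫ x, ‖torusGrad ψ x‖ ^ s := by
        refine integral_mono hint.integral_prod_right (integrable_const _) fun y => ?_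
        obtain ⟨v, rfl, hv⟩ := exists_toTorus_eq y
        refine (integral_abs_translate_sub_rpow_le hψ hs v).trans ?_
        gcongr
    _ = √d ^ s * ∫ x, ‖torusGrad ψ x‖ ^ s := by simp

end Poincare

/-! ### The inverse of the coupling and its convex primitive -/

section CouplingInverse

/-- The generalized inverse of `f x`, equal to `0` below the range of `f x`. -/
noncomputable def couplingInv {d : ℕ} (f : Torus d → ℝ → ℝ) (x : Torus d) (a : ℝ) : ℝ :=
  sSup {m : ℝ | m = 0 ∨ (0 < m ∧ f x m ≤ a)}

/-- The primitive of `couplingInv f x` vanishing at `0`. -/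
noncomputable def couplingPrim {d : ℕ} (f : Torus d → ℝ → ℝ) (x : Torus d) (a : ℝ) : ℝ :=
  ∫ s in (0 : ℝ)..a, couplingInv f x s

variable {d : ℕ} {f : Torus d → ℝ → ℝ} {q : ℝ}

theorem CouplingCond.exists_gt (hf : CouplingCond f q) (hq : 1 < q) (x : Torus d) (a : ℝ) :
    ∃ m, 0 < m ∧ a < f x m := by
  obtain ⟨C, hC, h⟩ := hf.growth
  have h1 : Tendsto (fun m : ℝ => 1 / C * m ^ (q - 1) - C) atTop atTop :=
    tendsto_atTop_add_const_right _ _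
      ((tendsto_rpow_atTop (by linarith)).const_mul_atTop (by positivity))
  obtain ⟨m, hm, hm1⟩ := ((h1.eventually_gt_atTop a).and (eventually_ge_atTop 1)).exists
  exact ⟨m, by linarith, hm.trans_le (h x m hm1).1⟩

theorem CouplingCond.bddAbove (hf : CouplingCond f q) (hq : 1 < q) (x : Torus d) (a : ℝ) :
    BddAbove {m : ℝ | m = 0 ∨ (0 < m ∧ f x m ≤ a)} := by
  obtain ⟨N, hN, hN'⟩ := hf.exists_gt hq x a
  refine ⟨N, ?_⟩
  rintro m (rfl | ⟨hm, hm'⟩)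
  · exact hN.le
  · by_contra! h
    exact absurd (hf.strictMonoOn x hN hm h) (by linarith)

theorem CouplingCond.continuousAt (hf : CouplingCond f q) (x : Torus d) {m : ℝ} (hm : 0 < m) :
    ContinuousAt (fun z : Torus d × ℝ => f z.1 z.2) (x, m) :=
  hf.continuousOn.continuousAt ((isOpen_univ.prod isOpen_Ioi).mem_nhds ⟨mem_univ _, hm⟩)

theorem CouplingCond.continuousAt_right (hf : CouplingCond f q) (x : Torus d) {m : ℝ}
    (hm : 0 < m) : ContinuousAt (f x) m :=
  ContinuousAt.comp (g := fun z : Torus d × ℝ => f z.1 z.2) (f := fun m => (x, m))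
    (hf.continuousAt x hm) (by fun_prop)

theorem CouplingCond.continuous_left (hf : CouplingCond f q) {m : ℝ} (hm : 0 < m) :
    Continuous fun x => f x m :=
  continuous_iff_continuousAt.2 fun x =>
    ContinuousAt.comp (g := fun z : Torus d × ℝ => f z.1 z.2) (f := fun x => (x, m))
      (hf.continuousAt x hm) (by fun_prop)

theorem CouplingCond.couplingInv_nonneg (hf : CouplingCond f q) (hq : 1 < q) (x : Torus d)
    (a : ℝ) : 0 ≤ couplingInv f x a :=
  le_csSup (hf.bddAbove hq x a) (Or.inl rfl)

/-- Galois connection between `f x` and its inverse. The forward direction rests on the left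
continuity of `f x`; the strict version `lt_couplingInv_iff` needs right continuity. -/
theorem CouplingCond.le_couplingInv_iff (hf : CouplingCond f q) (hq : 1 < q) {x : Torus d}
    {a m : ℝ} (hm : 0 < m) : m ≤ couplingInv f x a ↔ f x m ≤ a := by
  refine ⟨fun h => ?_, fun h => le_csSup (hf.bddAbove hq x a) (Or.inr ⟨hm, h⟩)⟩
  by_contra! h1
  have h2 : ∀ᶠ m' in 𝓝[<] m, 0 < m' ∧ a < f x m' ∧ m' < m := by
    have e1 := (hf.continuousAt_right x hm).eventually (lt_mem_nhds h1)
    exact ((lt_mem_nhds hm).filter_mono nhdsWithin_le_nhds).and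
      ((e1.filter_mono nhdsWithin_le_nhds).and self_mem_nhdsWithin)
  obtain ⟨m', hm', h3, h4⟩ := h2.exists
  refine absurd h (not_le.2 (lt_of_le_of_lt (csSup_le ⟨0, Or.inl rfl⟩ ?_) h4))
  rintro y (rfl | ⟨hy, hy'⟩)
  · exact hm'.le
  · by_contra! h
    exact absurd (hf.strictMonoOn x hm' hy h) (by linarith)

theorem CouplingCond.couplingInv_lt_iff (hf : CouplingCond f q) (hq : 1 < q) {x : Torus d}
    {a m : ℝ} (hm : 0 < m) : couplingInv f x a < m ↔ a < f x m := by
  rw [← not_le, hf.le_couplingInv_iff hq hm, not_le]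

theorem CouplingCond.lt_couplingInv_iff (hf : CouplingCond f q) (hq : 1 < q) {x : Torus d}
    {a m : ℝ} (hm : 0 < m) : m < couplingInv f x a ↔ f x m < a := by
  constructor
  · intro h
    exact (hf.strictMonoOn x hm (hm.trans h) h).trans_le
      ((hf.le_couplingInv_iff hq (hm.trans h)).1 le_rfl)
  · intro h
    have h2 : ∀ᶠ m' in 𝓝[>] m, f x m' < a ∧ m < m' :=
      (((hf.continuousAt_right x hm).eventually (gt_mem_nhds h)).filter_mono
        nhdsWithin_le_nhds).and self_mem_nhdsWithin
    obtain ⟨m', h3, h4⟩ := h2.exists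
    exact h4.trans_le ((hf.le_couplingInv_iff hq (hm.trans h4)).2 h3.le)

theorem CouplingCond.couplingInv_apply (hf : CouplingCond f q) (hq : 1 < q) (x : Torus d)
    {m : ℝ} (hm : 0 < m) : couplingInv f x (f x m) = m := by
  refine le_antisymm (not_lt.1 fun h => ?_) ((hf.le_couplingInv_iff hq hm).2 le_rfl)
  exact lt_irrefl _ ((hf.lt_couplingInv_iff hq hm).1 h)

theorem CouplingCond.apply_couplingInv (hf : CouplingCond f q) (hq : 1 < q) {x : Torus d}
    {a : ℝ} (h : 0 < couplingInv f x a) : f x (couplingInv f x a) = a := by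
  refine le_antisymm ((hf.le_couplingInv_iff hq h).1 le_rfl) (not_lt.1 fun h1 => ?_)
  exact lt_irrefl _ ((hf.lt_couplingInv_iff hq h).2 h1)

theorem CouplingCond.couplingInv_mono (hf : CouplingCond f q) (hq : 1 < q) (x : Torus d) :
    Monotone (couplingInv f x) := fun _ b hab =>
  csSup_le_csSup (hf.bddAbove hq x b) ⟨0, Or.inl rfl⟩
    fun _ hm => hm.imp id fun h => ⟨h.1, h.2.trans hab⟩

/-- At a positive level the strict Galois relations turn an inequality on the inverse into a strict
inequality between continuous functions of `(x, a)`, an open condition. At levels below zero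
nonnegativity suffices. -/
theorem CouplingCond.continuous_couplingInv (hf : CouplingCond f q) (hq : 1 < q) :
    Continuous (fun z : Torus d × ℝ => couplingInv f z.1 z.2) := by
  refine continuous_iff_continuousAt.2 fun ⟨x, a⟩ => tendsto_order.2 ⟨fun l hl => ?_, fun u hu => ?_⟩
  · rcases lt_or_ge l 0 with h | h
    · exact Eventually.of_forall fun z => h.trans_le (hf.couplingInv_nonneg hq _ _)
    · obtain ⟨m, hlm, hm⟩ := exists_between hl
      have hm0 : 0 < m := h.trans_lt hlm
      have h1 : ∀ᶠ z : Torus d × ℝ in 𝓝 (x, a), f z.1 m < z.2 :=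
        (((hf.continuous_left hm0).comp continuous_fst).continuousAt.eventually_lt
          continuous_snd.continuousAt ((hf.lt_couplingInv_iff hq hm0).1 hm))
      exact h1.mono fun z hz => hlm.trans ((hf.lt_couplingInv_iff hq hm0).2 hz)
  · have hu0 : 0 < u := (hf.couplingInv_nonneg hq x a).trans_lt hu
    have h1 : ∀ᶠ z : Torus d × ℝ in 𝓝 (x, a), z.2 < f z.1 u :=
      continuous_snd.continuousAt.eventually_lt
        ((hf.continuous_left hu0).comp continuous_fst).continuousAt
        ((hf.couplingInv_lt_iff hq hu0).1 hu)
    exact h1.mono fun z hz => (hf.couplingInv_lt_iff hq hu0).2 hz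

theorem CouplingCond.continuous_couplingInv_right (hf : CouplingCond f q) (hq : 1 < q)
    (x : Torus d) : Continuous (couplingInv f x) :=
  (hf.continuous_couplingInv hq).comp (by fun_prop : Continuous fun a : ℝ => (x, a))

theorem CouplingCond.continuous_couplingPrim (hf : CouplingCond f q) (hq : 1 < q) :
    Continuous (fun z : Torus d × ℝ => couplingPrim f z.1 z.2) :=
  intervalIntegral.continuous_parametric_primitive_of_continuous (f := couplingInv f)
    (hf.continuous_couplingInv hq)

/-- Tangent line inequality: the primitive of a nondecreasing function is convex. -/
theorem CouplingCond.couplingPrim_add_le (hf : CouplingCond f q) (hq : 1 < q) (x : Torus d)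
    (a b : ℝ) : couplingPrim f x a + couplingInv f x a * (b - a) ≤ couplingPrim f x b := by
  have hi : ∀ u v : ℝ, IntervalIntegrable (couplingInv f x) volume u v := fun u v =>
    (hf.continuous_couplingInv_right hq x).intervalIntegrable u v
  have h1 : couplingPrim f x b - couplingPrim f x a = ∫ s in a..b, couplingInv f x s :=
    intervalIntegral.integral_interval_sub_left (hi 0 b) (hi 0 a)
  have h2 : couplingInv f x a * (b - a) ≤ ∫ s in a..b, couplingInv f x s := by
    rcases le_total a b with h | h
    · have := intervalIntegral.integral_mono_on h (intervalIntegrable_const) (hi a b)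
        fun s hs => hf.couplingInv_mono hq x hs.1
      rw [intervalIntegral.integral_const, smul_eq_mul] at this
      linarith
    · have := intervalIntegral.integral_mono_on h (hi b a) (intervalIntegrable_const)
        fun s hs => hf.couplingInv_mono hq x hs.2
      rw [intervalIntegral.integral_const, smul_eq_mul] at this
      rw [intervalIntegral.integral_symm]
      linarith
  linarith

theorem CouplingCond.couplingPrim_mono (hf : CouplingCond f q) (hq : 1 < q) (x : Torus d) :
    Monotone (couplingPrim f x) := fun a b hab => by
  have h1 := hf.couplingPrim_add_le hq x a b
  have h2 := mul_nonneg (hf.couplingInv_nonneg hq x a) (sub_nonneg.2 hab)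
  linarith

theorem CouplingCond.couplingPrim_midpoint_le (hf : CouplingCond f q) (hq : 1 < q) (x : Torus d)
    (a b : ℝ) :
    couplingPrim f x ((a + b) / 2) ≤ (couplingPrim f x a + couplingPrim f x b) / 2 := by
  have h1 := hf.couplingPrim_add_le hq x ((a + b) / 2) a
  have h2 := hf.couplingPrim_add_le hq x ((a + b) / 2) b
  have h3 : couplingInv f x ((a + b) / 2) * (a - (a + b) / 2) +
    couplingInv f x ((a + b) / 2) * (b - (a + b) / 2) = 0 := by ring
  linarith

theorem CouplingCond.couplingInv_growth (hf : CouplingCond f q) (hq : 1 < q) :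
    ∃ K, 0 < K ∧ ∀ x a, couplingInv f x a ≤ K * (1 + |a|) ^ (1 / (q - 1)) := by
  obtain ⟨C, hC, h⟩ := hf.growth
  have hq0 : 0 < q - 1 := by linarith
  -- The summand `1` makes the base at least `1`, which settles values of the inverse below `1`,
  -- where no growth of `f` is assumed.
  refine ⟨(C * (1 + C) + 1) ^ (1 / (q - 1)), by positivity, fun x a => ?_⟩
  rw [← Real.mul_rpow (by positivity) (by positivity)]
  have h1 : (1 : ℝ) ≤ (C * (1 + C) + 1) * (1 + |a|) := by
    nlinarith [abs_nonneg a, mul_pos hC (by linarith : 0 < 1 + C),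
      mul_nonneg (mul_pos hC (by linarith : 0 < 1 + C)).le (abs_nonneg a)]
  rcases lt_or_ge (couplingInv f x a) 1 with hM | hM
  · exact hM.le.trans (Real.one_le_rpow h1 (by positivity))
  · have h2 := (h x _ hM).1
    rw [hf.apply_couplingInv hq (by linarith)] at h2
    have h3 : couplingInv f x a ^ (q - 1) ≤ C * (a + C) := by
      have : C * (1 / C * couplingInv f x a ^ (q - 1) - C) ≤ C * a := by gcongr
      have e : C * (1 / C * couplingInv f x a ^ (q - 1) - C) =
        couplingInv f x a ^ (q - 1) - C * C := by field_simp
      rw [e] at this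
      linarith
    rw [one_div, Real.le_rpow_inv_iff_of_pos (by linarith) (by linarith) hq0]
    refine h3.trans ?_
    have : C * a ≤ C * |a| := by gcongr; exact le_abs_self a
    nlinarith [abs_nonneg a, mul_nonneg (mul_pos hC hC).le (abs_nonneg a)]

/-- The tangent at `a = f x m` has slope `m`, and its intercept is continuous in `x`, hence bounded
on the compact torus. So every positive slope is available uniformly in `x`. -/
theorem CouplingCond.linear_le_couplingPrim (hf : CouplingCond f q) (hq : 1 < q) {m : ℝ}
    (hm : 0 < m) : ∃ K, ∀ x a, m * a - K ≤ couplingPrim f x a := by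
  have hc : Continuous fun x => m * f x m - couplingPrim f x (f x m) := by
    have h1 := hf.continuous_left hm
    have h2 := (hf.continuous_couplingPrim hq).comp (continuous_id.prodMk h1)
    exact (continuous_const.mul h1).sub h2
  obtain ⟨K, hK⟩ := (isCompact_range hc).bddAbove
  refine ⟨K, fun x a => ?_⟩
  have h1 := hf.couplingPrim_add_le hq x (f x m) a
  rw [hf.couplingInv_apply hq x hm] at h1
  have h2 := hK (mem_range_self x)
  linarith

/-- For large `a`, use the tangent at `a / 2`, whose slope is of order `a ^ (1 / (q - 1))`. For the
other `a ≥ -A`, the affine bound of slope one keeps the primitive bounded below. -/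
theorem CouplingCond.rpow_le_couplingPrim (hf : CouplingCond f q) (hq : 1 < q) (A : ℝ) :
    ∃ c K, 0 < c ∧ ∀ x a, -A ≤ a → c * (max a 0) ^ (q / (q - 1)) ≤ couplingPrim f x a + K := by
  obtain ⟨C, hC, h⟩ := hf.growth
  obtain ⟨K₁, hK₁⟩ := hf.linear_le_couplingPrim hq one_pos
  have hq0 : 0 < q - 1 := by linarith
  have hp : q / (q - 1) = 1 / (q - 1) + 1 := by field_simp; ring
  have hp0 : 0 < 1 / (q - 1) := by positivity
  set b := 1 / (q - 1) with hb
  set c : ℝ := 1 / 2 * (1 / (4 * C)) ^ b with hc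
  have hc0 : 0 < c := by positivity
  refine ⟨c, max 0 (A + K₁) + c * (4 * C) ^ (b + 1), hc0, fun x a ha => ?_⟩
  rw [hp]
  rcases le_total a (4 * C) with h4 | h4
  · have h5 : (max a 0) ^ (b + 1) ≤ (4 * C) ^ (b + 1) :=
      Real.rpow_le_rpow (le_max_right _ _) (max_le h4 (by positivity)) (by positivity)
    have h6 := hK₁ x a
    have h7 := le_max_right 0 (A + K₁)
    nlinarith
  · have ha0 : 0 < a := lt_of_lt_of_le (by positivity) h4
    rw [max_eq_left ha0.le]
    have h0 : couplingPrim f x 0 ≤ couplingPrim f x (a / 2) :=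
      hf.couplingPrim_mono hq x (by positivity)
    have h00 : couplingPrim f x 0 = 0 := intervalIntegral.integral_same
    have h5 := hf.couplingPrim_add_le hq x (a / 2) a
    -- At `m = (a / (4 * C)) ^ b`, the growth condition gives `f x m ≤ a / 4 + C`, which is at most
    -- `a / 2` once `a ≥ 4 * C`.
    have h6 : (a / (4 * C)) ^ b ≤ couplingInv f x (a / 2) := by
      have h1 : 1 ≤ a / (4 * C) := by rw [le_div_iff₀ (by positivity)]; linarith
      have h2 : (1 : ℝ) ≤ (a / (4 * C)) ^ b := Real.one_le_rpow h1 hp0.le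
      rw [hf.le_couplingInv_iff hq (by positivity)]
      refine (h x _ h2).2.trans ?_
      rw [← Real.rpow_mul (by positivity), hb, one_div_mul_cancel hq0.ne', Real.rpow_one]
      field_simp
      linarith
    have h7 : c * a ^ (b + 1) = (a / (4 * C)) ^ b * (a - a / 2) := by
      rw [hc, Real.rpow_add_one ha0.ne', div_eq_mul_one_div a (4 * C),
        Real.mul_rpow ha0.le (by positivity)]
      ring
    have h8 : (a / (4 * C)) ^ b * (a - a / 2) ≤ couplingInv f x (a / 2) * (a - a / 2) :=
      mul_le_mul_of_nonneg_right h6 (by linarith)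
    have h9 : 0 ≤ c * (4 * C) ^ (b + 1) := by positivity
    have h10 := le_max_left 0 (A + K₁)
    linarith

/-- The two conditions linking the density and the coupling determine the density. -/
theorem CouplingCond.eq_couplingInv (hf : CouplingCond f q) (hq : 1 < q) {x : Torus d}
    {a m : ℝ} (hm : 0 ≤ m) (h1 : 0 < m → a = f x m) (h2 : (a : EReal) ≤ couplingExt f x m) :
    m = couplingInv f x a := by
  rcases hm.lt_or_eq with h | rfl
  · rw [h1 h, hf.couplingInv_apply hq x h]
  · refine le_antisymm (hf.couplingInv_nonneg hq x a) (not_lt.1 fun h => ?_)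
    obtain ⟨s, hs0, hs⟩ := exists_between h
    have h3 := (hf.lt_couplingInv_iff hq hs0).1 hs
    rw [couplingExt, if_neg (lt_irrefl _)] at h2
    have h4 := h2.trans (iInf_le (fun s : Ioi (0 : ℝ) => (f x s : EReal)) ⟨s, hs0⟩)
    exact absurd (EReal.coe_le_coe_iff.1 h4) (not_le.2 h3)

theorem CouplingCond.le_couplingExt_couplingInv (hf : CouplingCond f q) (hq : 1 < q)
    (x : Torus d) (a : ℝ) : (a : EReal) ≤ couplingExt f x (couplingInv f x a) := by
  rw [couplingExt]
  split_ifs with h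
  · rw [hf.apply_couplingInv hq h]
  · refine le_iInf fun s => EReal.coe_le_coe_iff.2 ?_
    exact ((hf.couplingInv_lt_iff hq s.2).1 (lt_of_le_of_lt (not_lt.1 h) s.2)).le

end CouplingInverse

/-! ### Growth of the Hamiltonian, the density and the flux -/

section Hamiltonian

variable {d : ℕ} {H : Torus d → Vec d → ℝ} {r : ℝ}

theorem HamiltonianCond.hasGradientAt (hH : HamiltonianCond H r) (x : Torus d) (v : Vec d) :
    HasGradientAt (H x) (DpH H x v) v := (hH.differentiable x v).hasGradientAt

theorem HamiltonianCond.add_inner_le (hH : HamiltonianCond H r) (x : Torus d) (v w : Vec d) :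
    H x v + inner ℝ (DpH H x v) (w - v) ≤ H x w := by
  have h1 : ConvexOn ℝ univ fun t : ℝ => H x (v + t • (w - v)) := by
    have := (hH.convex x).comp_affineMap (AffineMap.lineMap v w : ℝ →ᵃ[ℝ] Vec d)
    simpa [Function.comp_def, AffineMap.lineMap_apply, add_comm] using this
  have h2 : HasDerivAt (fun t : ℝ => H x (v + t • (w - v))) (inner ℝ (DpH H x v) (w - v)) 0 := by
    have h3 : HasDerivAt (fun t : ℝ => v + t • (w - v)) (w - v) 0 := by
      simpa using ((hasDerivAt_id (0 : ℝ)).smul_const (w - v)).const_add v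
    have h4 : HasFDerivAt (H x) (InnerProductSpace.toDual ℝ (Vec d) (DpH H x v))
        (v + (0 : ℝ) • (w - v)) := by
      simpa using hasGradientAt_iff_hasFDerivAt.1 (hH.hasGradientAt x v)
    have h5 := h4.comp_hasDerivAt (0 : ℝ) h3
    rw [InnerProductSpace.toDual_apply_apply] at h5
    exact h5
  have h6 := h1.le_slope_of_hasDerivAt (mem_univ (0 : ℝ)) (mem_univ 1) one_pos h2
  simp [slope_def_field] at h6
  linarith

theorem HamiltonianCond.exists_lower (hH : HamiltonianCond H r) (hr : 1 < r) :
    ∃ C, 0 < C ∧ ∀ x v, ‖v‖ ^ r ≤ C * (H x v + C) ∧ -C ≤ H x v := by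
  obtain ⟨C, hC, h⟩ := hH.growth
  have hr0 : 0 < r := by linarith
  refine ⟨max C (r * C), lt_max_of_lt_left hC, fun x v => ?_⟩
  have h1 := (h x v).1
  have h2 : 0 ≤ 1 / (r * C) * ‖v‖ ^ r := by positivity
  have h3 : ‖v‖ ^ r ≤ r * C * (H x v + C) := by
    have h4 : r * C * (1 / (r * C) * ‖v‖ ^ r) ≤ r * C * (H x v + C) := by gcongr; linarith
    have e : r * C * (1 / (r * C) * ‖v‖ ^ r) = ‖v‖ ^ r := by field_simp
    linarith
  refine ⟨h3.trans (mul_le_mul (le_max_right _ _) ?_ (by linarith) ?_), ?_⟩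
  · linarith [le_max_left C (r * C)]
  · exact hC.le.trans (le_max_left _ _)
  · linarith [le_max_left C (r * C)]

theorem HamiltonianCond.exists_abs_le (hH : HamiltonianCond H r) (hr : 1 < r) :
    ∃ C, 0 < C ∧ ∀ x v, |H x v| ≤ C * (1 + ‖v‖) ^ r := by
  obtain ⟨C, hC, h⟩ := hH.growth
  have hr0 : 0 < r := by linarith
  refine ⟨C / r + C, by positivity, fun x v => ?_⟩
  have h1 := h x v
  have h2 : ‖v‖ ^ r ≤ (1 + ‖v‖) ^ r := by gcongr; linarith
  have h3 : (1 : ℝ) ≤ (1 + ‖v‖) ^ r := Real.one_le_rpow (by linarith [norm_nonneg v]) hr0.le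
  have h4 : 0 ≤ 1 / (r * C) * ‖v‖ ^ r := by positivity
  have h5 : C / r * ‖v‖ ^ r ≤ C / r * (1 + ‖v‖) ^ r := by gcongr
  have h6 : C * 1 ≤ C * (1 + ‖v‖) ^ r := by gcongr
  have h7 : 0 ≤ C / r * (1 + ‖v‖) ^ r := by positivity
  rw [abs_le, add_mul]
  constructor <;> linarith

/-- A convex function with growth of order `r` has gradient of order `r - 1`: in the gradient
inequality, move from `v` in the direction of the gradient by the length `1 + ‖v‖`, comparable to
the scale at which `H` is controlled. -/
theorem HamiltonianCond.exists_norm_DpH_le (hH : HamiltonianCond H r) (hr : 1 < r) :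
    ∃ C, 0 < C ∧ ∀ x v, ‖DpH H x v‖ ≤ C * (1 + ‖v‖) ^ (r - 1) := by
  obtain ⟨C, hC, h⟩ := hH.exists_abs_le hr
  have hr0 : 0 < r := by linarith
  refine ⟨C * 2 ^ r + C, by positivity, fun x v => ?_⟩
  have hv : 0 < 1 + ‖v‖ := by linarith [norm_nonneg v]
  rcases eq_or_ne (DpH H x v) 0 with h0 | h0
  · rw [h0, norm_zero]; positivity
  have hD : 0 < ‖DpH H x v‖ := norm_pos_iff.2 h0
  set e : Vec d := ((1 + ‖v‖) / ‖DpH H x v‖) • DpH H x v with he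
  have hen : ‖e‖ = 1 + ‖v‖ := by
    rw [he, norm_smul, Real.norm_of_nonneg (by positivity)]; field_simp
  have h1 := hH.add_inner_le x v (v + e)
  have h2 : inner ℝ (DpH H x v) (v + e - v) = (1 + ‖v‖) * ‖DpH H x v‖ := by
    rw [add_sub_cancel_left, he, inner_smul_right, real_inner_self_eq_norm_sq]; field_simp
  rw [h2] at h1
  have h3 : H x (v + e) ≤ C * 2 ^ r * (1 + ‖v‖) ^ r := by
    refine (le_abs_self _).trans ((h x _).trans ?_)
    rw [mul_assoc, ← Real.mul_rpow (by norm_num) hv.le]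
    gcongr
    have := norm_add_le v e
    linarith
  have h4 := neg_abs_le (H x v)
  have h5 := h x v
  have h6 : (1 + ‖v‖) * ‖DpH H x v‖ ≤ (1 + ‖v‖) * ((C * 2 ^ r + C) * (1 + ‖v‖) ^ (r - 1)) := by
    have e1 : (1 + ‖v‖) * ((C * 2 ^ r + C) * (1 + ‖v‖) ^ (r - 1)) =
        (C * 2 ^ r + C) * (1 + ‖v‖) ^ r := by
      rw [Real.rpow_sub_one hv.ne']; field_simp
    rw [e1]; linarith
  exact le_of_mul_le_mul_left h6 hv

variable {f : Torus d → ℝ → ℝ} {q : ℝ}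

theorem exists_couplingInv_le (hH : HamiltonianCond H r) (hr : 1 < r) (hf : CouplingCond f q)
    (hq : 1 < q) (Λ : ℝ) : ∃ K, 0 < K ∧ ∀ x v (lam : ℝ), |lam| ≤ Λ →
      couplingInv f x (lam + H x v) ≤ K * (1 + ‖v‖) ^ (r / (q - 1)) := by
  obtain ⟨C, hC, h⟩ := hH.exists_abs_le hr
  obtain ⟨K, hK, h'⟩ := hf.couplingInv_growth hq
  have hq0 : 0 < q - 1 := by linarith
  refine ⟨K * (1 + |Λ| + C) ^ (1 / (q - 1)), by positivity, fun x v lam hl => ?_⟩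
  refine (h' x _).trans ?_
  have hv : 1 ≤ 1 + ‖v‖ := by linarith [norm_nonneg v]
  have e : (1 + ‖v‖) ^ (r / (q - 1)) = ((1 + ‖v‖) ^ r) ^ (1 / (q - 1)) := by
    rw [← Real.rpow_mul (by linarith), mul_one_div]
  rw [e, mul_assoc, ← Real.mul_rpow (by positivity) (by positivity)]
  have h3 : (1 : ℝ) ≤ (1 + ‖v‖) ^ r := Real.one_le_rpow hv (by linarith)
  have h4 := abs_add_le lam (H x v)
  have h5 := h x v
  have h6 : 0 ≤ (1 + |Λ|) * ((1 + ‖v‖) ^ r - 1) := by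
    apply mul_nonneg (by positivity); linarith
  have h7 := le_abs_self Λ
  gcongr
  nlinarith

/-- The exponents `r / (q - 1)` of the density and `r - 1` of `DpH` add up to `pr - 1`. This places
the flux in the Lebesgue space dual to that of the gradient. -/
theorem exists_couplingInv_smul_DpH_le (hH : HamiltonianCond H r) (hr : 1 < r)
    (hf : CouplingCond f q) (hq : 1 < q) (Λ : ℝ) :
    ∃ K, 0 < K ∧ ∀ x v (lam : ℝ), |lam| ≤ Λ →
      ‖couplingInv f x (lam + H x v) • DpH H x v‖ ≤ K * (1 + ‖v‖) ^ (q / (q - 1) * r - 1) := by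
  obtain ⟨C, hC, h⟩ := hH.exists_norm_DpH_le hr
  obtain ⟨K, hK, h'⟩ := exists_couplingInv_le hH hr hf hq Λ
  refine ⟨K * C, by positivity, fun x v lam hl => ?_⟩
  have hq0 : 0 < q - 1 := by linarith
  have hv : 0 < 1 + ‖v‖ := by linarith [norm_nonneg v]
  have e : q / (q - 1) * r - 1 = r / (q - 1) + (r - 1) := by field_simp; ring
  rw [norm_smul, Real.norm_of_nonneg (hf.couplingInv_nonneg hq x _), e, Real.rpow_add hv,
    mul_mul_mul_comm]
  exact mul_le_mul (h' x v lam hl) (h x v) (norm_nonneg _) (by positivity)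

/-- Coercivity of the energy density: `H` controls `‖v‖ ^ r`, and `couplingPrim` controls the power
`p` of its positive argument. The lower bound on `H` supplies the restriction on the argument
required by `rpow_le_couplingPrim`. -/
theorem exists_norm_rpow_le_couplingPrim (hH : HamiltonianCond H r) (hr : 1 < r)
    (hf : CouplingCond f q) (hq : 1 < q) (Λ : ℝ) :
    ∃ K, 0 < K ∧ ∀ x v (lam : ℝ), |lam| ≤ Λ →
      ‖v‖ ^ (q / (q - 1) * r) ≤ K * (couplingPrim f x (lam + H x v) + K) := by
  obtain ⟨C, hC, h⟩ := hH.exists_lower hr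
  obtain ⟨c, K, hc, hK⟩ := hf.rpow_le_couplingPrim hq (|Λ| + C)
  have hq0 : 0 < q - 1 := by linarith
  set p := q / (q - 1) with hp
  have hp0 : 0 < p := by positivity
  set B : ℝ := C * (1 + |Λ| + C) with hB
  have hB0 : 0 < B := by positivity
  set L : ℝ := (2 * B) ^ p with hL
  have hL0 : 0 < L := by positivity
  refine ⟨max (L / c) (K + c), lt_max_of_lt_left (by positivity), fun x v lam hl => ?_⟩
  have h1 := h x v
  have hl' := abs_le.1 (hl.trans (le_abs_self Λ))
  have h2 := hK x (lam + H x v) (by linarith)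
  set a := lam + H x v with ha
  have h3 : ‖v‖ ^ r ≤ 2 * B * max 1 (max a 0) := by
    refine h1.1.trans ?_
    have h4 : H x v + C ≤ max a 0 + (|Λ| + C) := by linarith [le_max_left a 0]
    have h5 : C * (H x v + C) ≤ C * (max a 0 + (|Λ| + C)) := by gcongr
    refine h5.trans ?_
    have h6 := le_max_left 1 (max a 0)
    have h7 := le_max_right 1 (max a 0)
    set w := max 1 (max a 0)
    have h8 : max a 0 + (|Λ| + C) ≤ (1 + |Λ| + C) * w := by
      nlinarith [mul_nonneg (abs_nonneg Λ) (by linarith : 0 ≤ w - 1),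
        mul_nonneg hC.le (by linarith : 0 ≤ w - 1)]
    have h9 : 0 ≤ (1 + |Λ| + C) * w := by positivity
    rw [hB]
    nlinarith
  have h4 : ‖v‖ ^ (p * r) ≤ L * (1 + (max a 0) ^ p) := by
    rw [mul_comm, Real.rpow_mul (norm_nonneg _)]
    refine (Real.rpow_le_rpow (by positivity) h3 hp0.le).trans ?_
    rw [Real.mul_rpow (by positivity) (by positivity)]
    refine mul_le_mul_of_nonneg_left ?_ hL0.le
    rcases max_choice 1 (max a 0) with e | e <;> rw [e]
    · rw [Real.one_rpow]; linarith [Real.rpow_nonneg (le_max_right a 0) p]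
    · linarith
  have h5 : L * (1 + (max a 0) ^ p) ≤ L / c * (couplingPrim f x a + (K + c)) := by
    rw [div_mul_eq_mul_div, le_div_iff₀ hc]
    nlinarith
  have h6 : 0 ≤ couplingPrim f x a + (K + c) := by
    have := mul_nonneg hc.le (Real.rpow_nonneg (le_max_right a 0) p)
    linarith
  refine h4.trans (h5.trans (mul_le_mul (le_max_left _ _) ?_ h6 ?_))
  · linarith [le_max_right (L / c) (K + c)]
  · exact (by positivity : 0 ≤ L / c).trans (le_max_left _ _)

end Hamiltonian

/-! ### Uniform convexity of powers of the norm -/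

section UniformConvexity

variable {E : Type*} [NormedAddCommGroup E] [NormedSpace ℝ E]

theorem norm_midpoint_rpow_le {s : ℝ} (hs : 1 < s) (a b : E) :
    ‖(1 / 2 : ℝ) • (a + b)‖ ^ s ≤ (‖a‖ ^ s + ‖b‖ ^ s) / 2 := by
  have h1 : ‖(1 / 2 : ℝ) • (a + b)‖ ≤ (1 / 2 : ℝ) • ‖a‖ + (1 / 2 : ℝ) • ‖b‖ := by
    rw [norm_smul, Real.norm_of_nonneg (by norm_num), smul_eq_mul, smul_eq_mul, ← mul_add]
    gcongr
    exact norm_add_le a b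
  have h2 := (convexOn_rpow hs.le).2 (norm_nonneg a) (norm_nonneg b)
    (by norm_num : (0 : ℝ) ≤ 1 / 2) (by norm_num : (0 : ℝ) ≤ 1 / 2) (by norm_num)
  refine (Real.rpow_le_rpow (norm_nonneg _) h1 (by linarith)).trans (h2.trans_eq ?_)
  simp only [smul_eq_mul]
  ring

theorem norm_midpoint_rpow_lt [StrictConvexSpace ℝ E] {s : ℝ} (hs : 1 < s) {a b : E}
    (hab : a ≠ b) : ‖(1 / 2 : ℝ) • (a + b)‖ ^ s < (‖a‖ ^ s + ‖b‖ ^ s) / 2 := by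
  have hs0 : 0 < s := by linarith
  rcases eq_or_ne ‖a‖ ‖b‖ with h | h
  · have h1 := (norm_midpoint_lt_iff h).2 hab
    have h2 := Real.rpow_lt_rpow (norm_nonneg _) h1 hs0
    rw [← h]
    linarith
  · have h1 : ‖(1 / 2 : ℝ) • (a + b)‖ ≤ (1 / 2 : ℝ) • ‖a‖ + (1 / 2 : ℝ) • ‖b‖ := by
      rw [norm_smul, Real.norm_of_nonneg (by norm_num), smul_eq_mul, smul_eq_mul, ← mul_add]
      gcongr
      exact norm_add_le a b
    have h2 := (strictConvexOn_rpow hs).2 (norm_nonneg a) (norm_nonneg b) h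
      (by norm_num : (0 : ℝ) < 1 / 2) (by norm_num : (0 : ℝ) < 1 / 2) (by norm_num)
    refine (Real.rpow_le_rpow (norm_nonneg _) h1 hs0.le).trans_lt (h2.trans_eq ?_)
    simp only [smul_eq_mul]
    ring

/-- A quantitative form of the strict convexity of `‖·‖ ^ s`. -/
theorem exists_norm_sub_rpow_le [StrictConvexSpace ℝ E] [ProperSpace E] {s : ℝ} (hs : 1 < s)
    {ε : ℝ} (hε : 0 < ε) : ∃ K, 0 < K ∧ ∀ a b : E, ‖a - b‖ ^ s ≤ ε * (‖a‖ ^ s + ‖b‖ ^ s) +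
      K * ((‖a‖ ^ s + ‖b‖ ^ s) / 2 - ‖(1 / 2 : ℝ) • (a + b)‖ ^ s) := by
  have hs0 : 0 < s := by linarith
  have hr : ∀ {F : E × E → E}, Continuous F → Continuous fun z => ‖F z‖ ^ s := fun hF =>
    hF.norm.rpow_const fun _ => Or.inr hs0.le
  have c1 : Continuous fun z : E × E => ‖z.1‖ ^ s := hr continuous_fst
  have c2 : Continuous fun z : E × E => ‖z.2‖ ^ s := hr continuous_snd
  have c3 : Continuous fun z : E × E => ‖z.1 - z.2‖ ^ s := hr (by fun_prop)
  have c4 : Continuous fun z : E × E => ‖(1 / 2 : ℝ) • (z.1 + z.2)‖ ^ s := hr (by fun_prop)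
  -- By homogeneity only normalized pairs matter. Those that stay apart form a compact set, on which
  -- the strictly positive midpoint gap has a positive minimum `κ`.
  set S : Set (E × E) := {z | ‖z.1‖ ^ s + ‖z.2‖ ^ s = 1 ∧ ε ≤ ‖z.1 - z.2‖ ^ s} with hS
  have hle1 : ∀ z ∈ S, ‖z.1‖ ≤ 1 ∧ ‖z.2‖ ≤ 1 := by
    rintro z ⟨hz, -⟩
    have h1 := Real.rpow_nonneg (norm_nonneg z.1) s
    have h2 := Real.rpow_nonneg (norm_nonneg z.2) s
    constructor
    · exact not_lt.1 fun h => by linarith [Real.one_lt_rpow h hs0]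
    · exact not_lt.1 fun h => by linarith [Real.one_lt_rpow h hs0]
  have hScl : IsClosed S := (isClosed_eq (c1.add c2) continuous_const).inter
    (isClosed_le continuous_const c3)
  have hSc : IsCompact S := by
    refine (isCompact_closedBall (0 : E × E) 1).of_isClosed_subset hScl fun z hz => ?_
    rw [mem_closedBall_zero_iff, Prod.norm_def]
    exact max_le (hle1 z hz).1 (hle1 z hz).2
  obtain ⟨κ, hκ, hκS⟩ : ∃ κ, 0 < κ ∧ ∀ z ∈ S,
      κ ≤ (‖z.1‖ ^ s + ‖z.2‖ ^ s) / 2 - ‖(1 / 2 : ℝ) • (z.1 + z.2)‖ ^ s := by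
    rcases S.eq_empty_or_nonempty with h | h
    · exact ⟨1, one_pos, by simp [h]⟩
    · obtain ⟨z, hz, hmin⟩ := hSc.exists_isMinOn h
        (((c1.add c2).div_const 2).sub c4).continuousOn
      refine ⟨_, sub_pos.2 (norm_midpoint_rpow_lt hs (a := z.1) (b := z.2) fun h => ?_), hmin⟩
      have := hz.2
      rw [h, sub_self, norm_zero, Real.zero_rpow hs0.ne'] at this
      linarith
  have key : ∀ z : E × E, ‖z.1‖ ^ s + ‖z.2‖ ^ s = 1 → ‖z.1 - z.2‖ ^ s ≤ ε +
      2 ^ s / κ * ((‖z.1‖ ^ s + ‖z.2‖ ^ s) / 2 - ‖(1 / 2 : ℝ) • (z.1 + z.2)‖ ^ s) := by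
    intro z hz
    have h0 := sub_nonneg.2 (norm_midpoint_rpow_le hs z.1 z.2)
    have h2 : (0 : ℝ) ≤ 2 ^ s / κ := by positivity
    rcases le_total (‖z.1 - z.2‖ ^ s) ε with h | h
    · exact h.trans (le_add_of_nonneg_right (mul_nonneg h2 h0))
    · have h3 := hκS z ⟨hz, h⟩
      have h4 := hle1 z ⟨hz, h⟩
      have h5 : ‖z.1 - z.2‖ ^ s ≤ 2 ^ s := by
        gcongr
        linarith [norm_sub_le z.1 z.2]
      have h6 : (2 : ℝ) ^ s = 2 ^ s / κ * κ := by field_simp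
      have h7 := mul_le_mul_of_nonneg_left h3 h2
      linarith
  refine ⟨2 ^ s / κ, by positivity, fun a b => ?_⟩
  set N := ‖a‖ ^ s + ‖b‖ ^ s with hN
  have hN0 : 0 ≤ N := by positivity
  rcases hN0.eq_or_lt with h | h
  · have ha := Real.rpow_nonneg (norm_nonneg a) s
    have hb := Real.rpow_nonneg (norm_nonneg b) s
    have ha0 : a = 0 := by
      have : ‖a‖ ^ s = 0 := by linarith
      simpa [Real.rpow_eq_zero (norm_nonneg a) hs0.ne'] using this
    have hb0 : b = 0 := by
      have : ‖b‖ ^ s = 0 := by linarith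
      simpa [Real.rpow_eq_zero (norm_nonneg b) hs0.ne'] using this
    simp [hN, ha0, hb0, Real.zero_rpow hs0.ne']
  · set t : ℝ := N ^ (-(1 / s)) with ht
    have ht0 : 0 < t := by positivity
    have hts : t ^ s = N⁻¹ := by
      rw [ht, ← Real.rpow_mul hN0, neg_mul, one_div_mul_cancel hs0.ne', Real.rpow_neg_one]
    have hsc : ∀ u : E, ‖t • u‖ ^ s = N⁻¹ * ‖u‖ ^ s := fun u => by
      rw [norm_smul, Real.norm_of_nonneg ht0.le, Real.mul_rpow ht0.le (norm_nonneg _), hts]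
    have h1 := key (t • a, t • b) (by
      simp only [hsc]; rw [← mul_add, ← hN, inv_mul_cancel₀ h.ne'])
    simp only at h1
    rw [← smul_sub, ← smul_add, smul_comm, hsc, hsc, hsc, hsc] at h1
    have h2 := mul_le_mul_of_nonneg_left h1 hN0
    have e1 : ∀ y, N * (N⁻¹ * y) = y := fun y => by field_simp
    rw [e1] at h2
    refine h2.trans_eq ?_
    have e2 : N⁻¹ * ‖a‖ ^ s + N⁻¹ * ‖b‖ ^ s = N⁻¹ * N := by rw [hN, mul_add]
    rw [e2]
    field_simp

end UniformConvexity

/-! ### Minimizing sequences with vanishing convexity gap -/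

section MinimizingSequence

/-- A minimizing sequence for `J` along which the convexity gap of `N` tends to zero. -/
theorem exists_minimizing_seq {X : Type*} {A : Set X} (hA : A.Nonempty) (mid : X → X → X)
    (hmid : ∀ x ∈ A, ∀ y ∈ A, mid x y ∈ A) {J N : X → ℝ}
    (hJmid : ∀ x ∈ A, ∀ y ∈ A, J (mid x y) ≤ (J x + J y) / 2) {b : ℝ} (hb : ∀ x ∈ A, b ≤ J x)
    (hN0 : ∀ x ∈ A, 0 ≤ N x) (hN : ∀ c, ∃ B, ∀ x ∈ A, J x ≤ c → N x ≤ B) :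
    ∃ (c : ℝ) (x : ℕ → X) (δ : ℕ → ℝ), (∀ n, x n ∈ A) ∧ (∀ n, J (x n) ≤ c) ∧
      (∀ n, ∀ y ∈ A, J (x n) ≤ J y + 1 / ((n : ℝ) + 1)) ∧ Tendsto δ atTop (𝓝 0) ∧
      ∀ n m, n ≤ m → (N (x n) + N (x m)) / 2 - N (mid (x n) (x m)) ≤ δ n := by
  set I := sInf (J '' A) with hI
  have hbdd : BddBelow (J '' A) := ⟨b, by rintro _ ⟨x, hx, rfl⟩; exact hb x hx⟩
  have hIle : ∀ y ∈ A, I ≤ J y := fun y hy => csInf_le hbdd ⟨y, hy, rfl⟩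
  have hpos : ∀ n : ℕ, (0 : ℝ) < 1 / ((n : ℝ) + 1) := fun n => by positivity
  have hanti : ∀ n m : ℕ, n ≤ m → 1 / ((m : ℝ) + 1) ≤ 1 / ((n : ℝ) + 1) := fun n m h => by
    gcongr
  set C : ℕ → Set X := fun n => {x ∈ A | J x ≤ I + 1 / ((n : ℝ) + 1)} with hC
  have hCne : ∀ n, (C n).Nonempty := fun n => by
    obtain ⟨_, ⟨x, hx, rfl⟩, hx'⟩ := exists_lt_of_csInf_lt (hA.image J)
      (lt_add_of_pos_right I (hpos n))
    exact ⟨x, hx, hx'.le⟩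
  have hCanti : ∀ n m, n ≤ m → C m ⊆ C n := fun n m h x hx =>
    ⟨hx.1, hx.2.trans (by linarith [hanti n m h])⟩
  -- The sublevel sets shrink, so these infima increase, and they stay bounded by coercivity; hence
  -- they converge to some `L`. A midpoint of points from `C n` stays in `C n`, where `N ≥ ν n`,
  -- while the endpoints have `N` at most `L` up to a small error. The gap is therefore at most `(L
  -- - ν n) / 2` plus that error.
  set ν : ℕ → ℝ := fun n => sInf (N '' C n) with hν
  have hνb : ∀ n, BddBelow (N '' C n) := fun n =>
    ⟨0, by rintro _ ⟨x, hx, rfl⟩; exact hN0 x hx.1⟩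
  have hνle : ∀ n, ∀ y ∈ C n, ν n ≤ N y := fun n y hy => csInf_le (hνb n) ⟨y, hy, rfl⟩
  have hνmono : Monotone ν := fun n m h =>
    csInf_le_csInf (hνb n) ((hCne m).image N) (image_mono (hCanti n m h))
  have hc0 : ∀ n, ∀ x ∈ C n, J x ≤ I + 1 := fun n x hx => by
    have := (hCanti 0 n (Nat.zero_le n) hx).2
    simpa using this
  obtain ⟨B, hB⟩ := hN (I + 1)
  have hνB : BddAbove (range ν) := ⟨B, by
    rintro _ ⟨n, rfl⟩
    obtain ⟨x, hx⟩ := hCne n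
    exact (hνle n x hx).trans (hB x hx.1 (hc0 n x hx))⟩
  have hνlim := tendsto_atTop_ciSup hνmono hνB
  set L := ⨆ n, ν n
  have hνL : ∀ n, ν n ≤ L := fun n => le_ciSup hνB n
  have hx : ∀ n, ∃ x ∈ C n, N x < ν n + 1 / ((n : ℝ) + 1) := fun n => by
    obtain ⟨_, ⟨x, hx, rfl⟩, hx'⟩ := exists_lt_of_csInf_lt ((hCne n).image N)
      (lt_add_of_pos_right (ν n) (hpos n))
    exact ⟨x, hx, hx'⟩
  choose x hxC hxN using hx
  refine ⟨I + 1, x, fun n => (L - ν n) / 2 + 1 / ((n : ℝ) + 1), fun n => (hxC n).1,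
    fun n => hc0 n _ (hxC n), fun n y hy => ?_, ?_, fun n m hnm => ?_⟩
  · linarith [(hxC n).2, hIle y hy]
  · have h1 := ((tendsto_const_nhds (x := L)).sub hνlim).div_const 2
    simpa using h1.add tendsto_one_div_add_atTop_nhds_zero_nat
  · have h1 : mid (x n) (x m) ∈ C n := by
      have h2 := hCanti n m hnm (hxC m)
      refine ⟨hmid _ (hxC n).1 _ h2.1, ?_⟩
      linarith [hJmid _ (hxC n).1 _ h2.1, (hxC n).2, h2.2]
    linarith [hνle n _ h1, hxN n, hxN m, hνL m, hanti n m hnm]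

end MinimizingSequence

/-! ### Completeness and limits in the Sobolev space -/

section SobolevLimit

theorem exists_tendsto_eLpNorm_of_cauchy {Ω E : Type*} [MeasurableSpace Ω] {μ : Measure Ω}
    [NormedAddCommGroup E] [CompleteSpace E] {s : ℝ} (hs : 1 ≤ s) {F : ℕ → Ω → E}
    (hF : ∀ n, MemLp (F n) (ENNReal.ofReal s) μ)
    (hc : ∀ ε > 0, ∃ N, ∀ n ≥ N, ∫ x, ‖F n x - F N x‖ ^ s ∂μ ≤ ε) :
    ∃ G : Ω → E, MemLp G (ENNReal.ofReal s) μ ∧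
      Tendsto (fun n => eLpNorm (F n - G) (ENNReal.ofReal s) μ) atTop (𝓝 0) := by
  have hs0 : 0 < s := by linarith
  have : Fact (1 ≤ ENNReal.ofReal s) := ⟨by simpa using hs⟩
  have hp0 : ENNReal.ofReal s ≠ 0 := by simpa using hs0
  have hcau : CauchySeq fun n => (hF n).toLp (F n) := by
    refine Metric.cauchySeq_iff'.2 fun ε hε => ?_
    obtain ⟨N, hN⟩ := hc ((ε / 2) ^ s) (by positivity)
    refine ⟨N, fun n hn => ?_⟩
    rw [dist_eq_norm, ← MemLp.toLp_sub, Lp.norm_toLp,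
      MemLp.eLpNorm_eq_integral_rpow_norm hp0 ENNReal.ofReal_ne_top ((hF n).sub (hF N)),
      ENNReal.toReal_ofReal hs0.le, ENNReal.toReal_ofReal (by positivity)]
    have h1 : (∫ x, ‖(F n - F N) x‖ ^ s ∂μ) ^ s⁻¹ ≤ ((ε / 2) ^ s) ^ s⁻¹ := by
      refine Real.rpow_le_rpow (by positivity) (hN n hn) (by positivity)
    rw [← Real.rpow_mul (by positivity), mul_inv_cancel₀ hs0.ne', Real.rpow_one] at h1
    linarith
  obtain ⟨G, hG⟩ := cauchySeq_tendsto_of_complete hcau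
  refine ⟨G, Lp.memLp G, ?_⟩
  rw [← Lp.toLp_coeFn G (Lp.memLp G)] at hG
  exact (Lp.tendsto_Lp_iff_tendsto_eLpNorm'' F hF G (Lp.memLp G)).1 hG

theorem tendsto_integral_mul_of_tendsto_eLpNorm {X : Type*} [TopologicalSpace X] [CompactSpace X]
    [MeasurableSpace X] [OpensMeasurableSpace X] {μ : Measure X}
    [IsProbabilityMeasure μ] {p : ENNReal} (hp : 1 ≤ p) {F : ℕ → X → ℝ} {G h : X → ℝ}
    (hF : ∀ n, MemLp (F n) p μ) (hG : MemLp G p μ) (hh : Continuous h)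
    (hlim : Tendsto (fun n => eLpNorm (F n - G) p μ) atTop (𝓝 0)) :
    Tendsto (fun n => ∫ x, F n x * h x ∂μ) atTop (𝓝 (∫ x, G x * h x ∂μ)) := by
  obtain ⟨C, hC⟩ := (isCompact_range hh.norm).bddAbove
  have hC' : ∀ x, ‖h x‖ ≤ C := fun x => hC (mem_range_self x)
  have hi : ∀ {u : X → ℝ}, MemLp u p μ → Integrable (fun x => u x * h x) μ := fun hu =>
    (hu.integrable hp).mul_bdd (c := C) hh.aestronglyMeasurable (Eventually.of_forall hC')
  refine tendsto_integral_of_L1' _ (hi hG).1 (Eventually.of_forall fun n => hi (hF n)) ?_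
  have hb : Tendsto (fun n => ENNReal.ofReal C * eLpNorm (F n - G) p μ) atTop (𝓝 0) := by
    simpa using ENNReal.Tendsto.const_mul hlim (Or.inr ENNReal.ofReal_ne_top)
  refine tendsto_of_tendsto_of_tendsto_of_le_of_le tendsto_const_nhds hb (fun _ => zero_le)
    fun n => ?_
  calc eLpNorm ((fun x => F n x * h x) - fun x => G x * h x) 1 μ
      ≤ ENNReal.ofReal C * eLpNorm (F n - G) 1 μ := by
        refine eLpNorm_le_mul_eLpNorm_of_ae_le_mul (Eventually.of_forall fun x => ?_) 1
        simp only [Pi.sub_apply]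
        rw [← sub_mul, norm_mul, mul_comm]
        exact mul_le_mul_of_nonneg_right (hC' x) (norm_nonneg _)
    _ ≤ ENNReal.ofReal C * eLpNorm (F n - G) p μ := by
        gcongr
        exact eLpNorm_le_eLpNorm_of_exponent_le hp ((hF n).sub hG).1

variable {d : ℕ}

theorem SmoothOnTorus.sub {ψ η : Torus d → ℝ} (hψ : SmoothOnTorus ψ) (hη : SmoothOnTorus η) :
    SmoothOnTorus (fun x => ψ x - η x) := ContDiff.sub hψ hη

theorem torusGrad_sub {ψ η : Torus d → ℝ} (hψ : SmoothOnTorus ψ) (hη : SmoothOnTorus η)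
    (x : Torus d) : torusGrad (fun x => ψ x - η x) x = torusGrad ψ x - torusGrad η x := by
  have h := torusGrad_add hψ (hη.const_mul (-1)) x
  rw [torusGrad_const_mul hη, neg_one_smul, ← sub_eq_add_neg] at h
  simpa [sub_eq_add_neg] using h

theorem memLp_of_continuous {E : Type*} [NormedAddCommGroup E]
    {F : Torus d → E} (hF : Continuous F) (p : ENNReal) : MemLp F p volume :=
  hF.memLp_of_hasCompactSupport (HasCompactSupport.of_compactSpace F)

theorem tendsto_eLpNorm_apply {p : ENNReal} {F : ℕ → Torus d → Vec d} {G : Torus d → Vec d}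
    (hlim : Tendsto (fun n => eLpNorm (F n - G) p volume) atTop (𝓝 0)) (i : Fin d) :
    Tendsto (fun n => eLpNorm ((fun x => F n x i) - fun x => G x i) p volume) atTop (𝓝 0) := by
  refine tendsto_of_tendsto_of_tendsto_of_le_of_le tendsto_const_nhds hlim (fun _ => zero_le)
    fun n => eLpNorm_mono fun x => ?_
  exact PiLp.norm_apply_le (F n x - G x) i

theorem memLp_vec_apply {p : ENNReal} {G : Torus d → Vec d} (hG : MemLp G p volume) (i : Fin d) :
    MemLp (fun x => G x i) p volume :=
  hG.mono ((by fun_prop : Continuous fun v : Vec d => v i).comp_aestronglyMeasurable hG.1)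
    (Eventually.of_forall fun x => PiLp.norm_apply_le (G x) i)

theorem hasSobolevGrad_of_tendsto {p : ENNReal} (hp : 1 ≤ p) {ψ : ℕ → Torus d → ℝ}
    (hψ : ∀ n, SmoothOnTorus (ψ n)) {φ : Torus d → ℝ} {g : Torus d → Vec d}
    (hφ : MemLp φ p volume) (hg : MemLp g p volume)
    (hlim : Tendsto (fun n => eLpNorm (ψ n - φ) p volume) atTop (𝓝 0))
    (hlim' : Tendsto (fun n => eLpNorm (torusGrad (ψ n) - g) p volume) atTop (𝓝 0)) :
    HasSobolevGrad p φ g where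
  memLp := hφ
  memLp_grad := hg
  integral_by_parts η hη i := by
    have hi : Continuous fun v : Vec d => v i := by fun_prop
    have h1 := tendsto_integral_mul_of_tendsto_eLpNorm hp
      (fun n => memLp_of_continuous (hψ n).continuous p) hφ (hi.comp hη.continuous_torusGrad) hlim
    have h2 := tendsto_integral_mul_of_tendsto_eLpNorm hp
      (fun n => memLp_vec_apply (memLp_of_continuous (hψ n).continuous_torusGrad p) i)
      (memLp_vec_apply hg i) hη.continuous (tendsto_eLpNorm_apply hlim' i)
    refine tendsto_nhds_unique h1 ?_
    simp only [Function.comp_def, integral_mul_torusGrad (hψ _) hη]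
    exact h2.neg

/-- A sequence of smooth functions whose gradients are Cauchy in `L^s` converges, after
subtraction of the means, in the Sobolev space. -/
theorem exists_hasSobolevGrad_of_cauchy {s : ℝ} (hs : 1 ≤ s) {ψ : ℕ → Torus d → ℝ}
    (hψ : ∀ n, SmoothOnTorus (ψ n))
    (hc : ∀ ε > 0, ∃ N, ∀ n ≥ N, ∫ x, ‖torusGrad (ψ n) x - torusGrad (ψ N) x‖ ^ s ≤ ε) :
    ∃ φ g, HasSobolevGrad (ENNReal.ofReal s) φ g ∧
      Tendsto (fun n => eLpNorm (torusGrad (ψ n) - g) (ENNReal.ofReal s) volume) atTop (𝓝 0) := by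
  obtain ⟨g, hg, hglim⟩ := exists_tendsto_eLpNorm_of_cauchy hs
    (fun n => memLp_of_continuous (hψ n).continuous_torusGrad (ENNReal.ofReal s)) hc
  have hψ' : ∀ n, SmoothOnTorus fun x => ψ n x - ∫ y, ψ n y := fun n =>
    (hψ n).sub (SmoothOnTorus.const _)
  have hgrad : ∀ n, torusGrad (fun x => ψ n x - ∫ y, ψ n y) = torusGrad (ψ n) := fun n => by
    funext x
    rw [torusGrad_sub (hψ n) (SmoothOnTorus.const _), torusGrad_const, sub_zero]
  have hc' : ∀ ε > 0, ∃ N, ∀ n ≥ N,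
      ∫ x, ‖(ψ n x - ∫ y, ψ n y) - (ψ N x - ∫ y, ψ N y)‖ ^ s ≤ ε := by
    intro ε hε
    -- Adding `1` to the Poincaré constant avoids a division by zero when `d = 0`.
    have hD : 0 < √(d : ℝ) ^ s + 1 := by positivity
    obtain ⟨N, hN⟩ := hc (ε / (√d ^ s + 1)) (by positivity)
    refine ⟨N, fun n hn => ?_⟩
    have h1 := poincare ((hψ n).sub (hψ N)) hs
    have h2 : ∀ x, |ψ n x - ψ N x - ∫ y, (ψ n y - ψ N y)| =
        ‖(ψ n x - ∫ y, ψ n y) - (ψ N x - ∫ y, ψ N y)‖ := fun x => by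
      rw [integral_sub (integrable_of_continuous (hψ n).continuous)
        (integrable_of_continuous (hψ N).continuous), Real.norm_eq_abs]
      congr 1; ring
    simp only [h2, torusGrad_sub (hψ n) (hψ N)] at h1
    refine h1.trans ?_
    calc √d ^ s * ∫ x, ‖torusGrad (ψ n) x - torusGrad (ψ N) x‖ ^ s
        ≤ (√d ^ s + 1) * (ε / (√d ^ s + 1)) := by
          gcongr
          · linarith
          · exact hN n hn
      _ = ε := by field_simp
  obtain ⟨φ, hφ, hφlim⟩ := exists_tendsto_eLpNorm_of_cauchy hs
    (fun n => memLp_of_continuous (hψ' n).continuous (ENNReal.ofReal s)) hc'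
  refine ⟨φ, g, hasSobolevGrad_of_tendsto (by simpa using hs) hψ' hφ hg hφlim ?_, hglim⟩
  simpa only [hgrad] using hglim

end SobolevLimit

/-! ### The convex energy: convexity, coercivity and first variation -/

section Energy

variable {d : ℕ} {H : Torus d → Vec d → ℝ} {f : Torus d → ℝ → ℝ} {q r : ℝ}

/-- The energy whose minimizers solve the mean field game system. -/
noncomputable def energy (H : Torus d → Vec d → ℝ) (f : Torus d → ℝ → ℝ) (lam : ℝ)
    (ψ : Torus d → ℝ) : ℝ :=
  (∫ x, couplingPrim f x (lam + H x (torusGrad ψ x))) - lam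

/-- The derivative of the energy density in the direction `(μ, e)`. -/
noncomputable def energyDeriv (H : Torus d → Vec d → ℝ) (f : Torus d → ℝ → ℝ) (lam : ℝ)
    (μ : ℝ) (x : Torus d) (v e : Vec d) : ℝ :=
  couplingInv f x (lam + H x v) * (μ + inner ℝ (DpH H x v) e)

theorem HamiltonianCond.continuous_comp {X : Type*} [TopologicalSpace X]
    (hH : HamiltonianCond H r) {y : X → Torus d} {v : X → Vec d} (hy : Continuous y)
    (hv : Continuous v) : Continuous fun x => H (y x) (v x) :=
  hH.continuous.comp (hy.prodMk hv)

theorem HamiltonianCond.continuous_DpH_comp {X : Type*} [TopologicalSpace X]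
    (hH : HamiltonianCond H r) {y : X → Torus d} {v : X → Vec d} (hy : Continuous y)
    (hv : Continuous v) : Continuous fun x => DpH H (y x) (v x) :=
  hH.continuous_DpH.comp (hy.prodMk hv)

theorem CouplingCond.continuous_couplingInv_comp {X : Type*} [TopologicalSpace X]
    (hf : CouplingCond f q) (hq : 1 < q) {y : X → Torus d} {a : X → ℝ} (hy : Continuous y)
    (ha : Continuous a) : Continuous fun x => couplingInv f (y x) (a x) :=
  (hf.continuous_couplingInv hq).comp (hy.prodMk ha)

theorem continuous_energyDeriv (hH : HamiltonianCond H r) (hf : CouplingCond f q) (hq : 1 < q)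
    (μ : ℝ) : Continuous fun z : ℝ × Torus d × Vec d × Vec d =>
      energyDeriv H f z.1 μ z.2.1 z.2.2.1 z.2.2.2 := by
  have c1 : Continuous fun z : ℝ × Torus d × Vec d × Vec d => z.2.1 := by fun_prop
  have c2 : Continuous fun z : ℝ × Torus d × Vec d × Vec d => z.2.2.1 := by fun_prop
  exact (hf.continuous_couplingInv_comp hq c1
    (continuous_fst.add (hH.continuous_comp c1 c2))).mul
    (continuous_const.add ((hH.continuous_DpH_comp c1 c2).inner (by fun_prop)))

theorem integrable_couplingPrim (hH : HamiltonianCond H r) (hf : CouplingCond f q) (hq : 1 < q)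
    (lam : ℝ) {v : Torus d → Vec d} (hv : Continuous v) :
    Integrable fun x => couplingPrim f x (lam + H x (v x)) :=
  integrable_of_continuous ((hf.continuous_couplingPrim hq).comp
    (continuous_id.prodMk (continuous_const.add (hH.continuous_comp continuous_id hv))))

theorem SmoothOnTorus.midpoint {ψ η : Torus d → ℝ} (hψ : SmoothOnTorus ψ)
    (hη : SmoothOnTorus η) : SmoothOnTorus fun x => 1 / 2 * (ψ x + η x) :=
  (hψ.add hη).const_mul _

theorem torusGrad_midpoint {ψ η : Torus d → ℝ} (hψ : SmoothOnTorus ψ) (hη : SmoothOnTorus η)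
    (x : Torus d) : torusGrad (fun x => 1 / 2 * (ψ x + η x)) x =
      (1 / 2 : ℝ) • (torusGrad ψ x + torusGrad η x) := by
  rw [torusGrad_const_mul (hψ.add hη), torusGrad_add hψ hη]

/-- A convex nondecreasing function composed with the jointly convex map `(l, v) ↦ l + H x v` is
jointly convex. -/
theorem energy_midpoint_le (hH : HamiltonianCond H r) (hf : CouplingCond f q) (hq : 1 < q)
    (l₁ l₂ : ℝ) {ψ η : Torus d → ℝ} (hψ : SmoothOnTorus ψ) (hη : SmoothOnTorus η) :
    energy H f ((l₁ + l₂) / 2) (fun x => 1 / 2 * (ψ x + η x)) ≤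
      (energy H f l₁ ψ + energy H f l₂ η) / 2 := by
  have i1 := integrable_couplingPrim hH hf hq l₁ hψ.continuous_torusGrad
  have i2 := integrable_couplingPrim hH hf hq l₂ hη.continuous_torusGrad
  have h1 : ∫ x, couplingPrim f x
      ((l₁ + l₂) / 2 + H x (torusGrad (fun x => 1 / 2 * (ψ x + η x)) x)) ≤
      ∫ x, (couplingPrim f x (l₁ + H x (torusGrad ψ x)) +
        couplingPrim f x (l₂ + H x (torusGrad η x))) / 2 := by
    refine integral_mono (integrable_couplingPrim hH hf hq _
      (hψ.midpoint hη).continuous_torusGrad) ((i1.add i2).div_const 2) fun x => ?_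
    refine le_trans (hf.couplingPrim_mono hq x ?_) (hf.couplingPrim_midpoint_le hq x _ _)
    have h2 := (hH.convex x).2 (mem_univ (torusGrad ψ x)) (mem_univ (torusGrad η x))
      (by norm_num : (0 : ℝ) ≤ 1 / 2) (by norm_num : (0 : ℝ) ≤ 1 / 2) (by norm_num)
    rw [torusGrad_midpoint hψ hη, smul_add]
    simp only [smul_eq_mul] at h2
    linarith
  rw [integral_div, integral_add i1 i2] at h1
  simp only [energy]
  linarith

/-- An affine minorant of `couplingPrim` of slope `m` bounds the energy below by `(m - 1) * lam` up
to a constant. Slopes on either side of `1`, here `2` and `1 / 2`, control both signs of `lam`. -/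
theorem exists_abs_le_energy (hH : HamiltonianCond H r) (hr : 1 < r) (hf : CouplingCond f q)
    (hq : 1 < q) : ∃ K, ∀ (lam : ℝ) (ψ : Torus d → ℝ), SmoothOnTorus ψ →
      |lam| ≤ 2 * (energy H f lam ψ + K) := by
  obtain ⟨C, hC, h⟩ := hH.exists_lower hr
  have key : ∀ m : ℝ, 0 < m → ∃ K, ∀ (lam : ℝ) (ψ : Torus d → ℝ), SmoothOnTorus ψ →
      (m - 1) * lam - K ≤ energy H f lam ψ := by
    intro m hm
    obtain ⟨K, hK⟩ := hf.linear_le_couplingPrim hq hm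
    refine ⟨m * C + K, fun lam ψ hψ => ?_⟩
    have h1 : ∫ _x : Torus d, (m * (lam - C) - K) ≤
        ∫ x, couplingPrim f x (lam + H x (torusGrad ψ x)) := by
      refine integral_mono (integrable_const _)
        (integrable_couplingPrim hH hf hq lam hψ.continuous_torusGrad) fun x => ?_
      refine le_trans ?_ (hK x _)
      have h2 : m * (lam - C) ≤ m * (lam + H x (torusGrad ψ x)) := by
        gcongr
        linarith [(h x (torusGrad ψ x)).2]
      linarith
    rw [integral_const, probReal_univ, one_smul] at h1
    simp only [energy]
    linarith
  obtain ⟨K₁, hK₁⟩ := key 2 two_pos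
  obtain ⟨K₂, hK₂⟩ := key (1 / 2) (by norm_num)
  refine ⟨max K₁ K₂, fun lam ψ hψ => ?_⟩
  have h1 := hK₁ lam ψ hψ
  have h2 := hK₂ lam ψ hψ
  have h3 := le_max_left K₁ K₂
  have h4 := le_max_right K₁ K₂
  rcases abs_cases lam with ⟨e, _⟩ | ⟨e, _⟩ <;> rw [e] <;> linarith

theorem exists_integral_norm_rpow_le (hH : HamiltonianCond H r) (hr : 1 < r)
    (hf : CouplingCond f q) (hq : 1 < q) (c : ℝ) :
    ∃ Λ B, ∀ (lam : ℝ) (ψ : Torus d → ℝ), SmoothOnTorus ψ → energy H f lam ψ ≤ c →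
      |lam| ≤ Λ ∧ ∫ x, ‖torusGrad ψ x‖ ^ (q / (q - 1) * r) ≤ B := by
  obtain ⟨K, hK⟩ := exists_abs_le_energy hH hr hf hq
  obtain ⟨L, hL, hL'⟩ := exists_norm_rpow_le_couplingPrim hH hr hf hq (2 * (c + K))
  refine ⟨2 * (c + K), L * (c + 2 * (c + K) + L), fun lam ψ hψ he => ?_⟩
  have h1 : |lam| ≤ 2 * (c + K) := (hK lam ψ hψ).trans (by linarith)
  refine ⟨h1, ?_⟩
  have i1 := integrable_couplingPrim hH hf hq lam hψ.continuous_torusGrad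
  have hs : 0 ≤ q / (q - 1) * r :=
    mul_nonneg (div_nonneg (by linarith) (by linarith)) (by linarith)
  have h2 : ∫ x, ‖torusGrad ψ x‖ ^ (q / (q - 1) * r) ≤
      ∫ x, L * (couplingPrim f x (lam + H x (torusGrad ψ x)) + L) :=
    integral_mono (integrable_of_continuous (hψ.continuous_torusGrad.norm.rpow_const
      fun _ => Or.inr hs)) ((i1.add (integrable_const L)).const_mul L) fun x => hL' x _ lam h1
  rw [integral_const_mul, integral_add i1 (integrable_const L), integral_const, probReal_univ,
    one_smul] at h2
  refine h2.trans ?_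
  simp only [energy] at he
  have h3 := le_abs_self lam
  gcongr
  linarith

/-- The tangent inequality is taken at the perturbed point and evaluated at the original one. It
bounds the increment from above by a derivative at the perturbed point, so no differentiation under
the integral is needed. -/
theorem energy_sub_le (hH : HamiltonianCond H r) (hf : CouplingCond f q)
    (hq : 1 < q) (lam μ : ℝ) {t : ℝ} {ψ η : Torus d → ℝ} (hψ : SmoothOnTorus ψ)
    (hη : SmoothOnTorus η) :
    energy H f (lam + t * μ) (fun x => ψ x + t * η x) - energy H f lam ψ ≤
      t * ((∫ x, energyDeriv H f (lam + t * μ) μ x (torusGrad ψ x + t • torusGrad η x)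
        (torusGrad η x)) - μ) := by
  have hD : ∀ x, torusGrad (fun x => ψ x + t * η x) x = torusGrad ψ x + t • torusGrad η x :=
    fun x => by rw [torusGrad_add hψ (hη.const_mul t), torusGrad_const_mul hη]
  have i1 := integrable_couplingPrim hH hf hq lam hψ.continuous_torusGrad
  have i2 := integrable_couplingPrim hH hf hq (lam + t * μ)
    (hψ.add (hη.const_mul t)).continuous_torusGrad
  have i3 : Integrable fun x => energyDeriv H f (lam + t * μ) μ x
      (torusGrad ψ x + t • torusGrad η x) (torusGrad η x) := by
    refine integrable_of_continuous ((continuous_energyDeriv hH hf hq μ).comp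
      (continuous_const.prodMk (continuous_id.prodMk (Continuous.prodMk ?_ ?_))))
    · exact hψ.continuous_torusGrad.add (hη.continuous_torusGrad.const_smul t)
    · exact hη.continuous_torusGrad
  have h1 : (∫ x, couplingPrim f x (lam + t * μ + H x (torusGrad (fun x => ψ x + t * η x) x))) -
      ∫ x, couplingPrim f x (lam + H x (torusGrad ψ x)) ≤
      t * ∫ x, energyDeriv H f (lam + t * μ) μ x (torusGrad ψ x + t • torusGrad η x)
        (torusGrad η x) := by
    rw [← integral_sub i2 i1, ← integral_const_mul]
    refine integral_mono (i2.sub i1) (i3.const_mul t) fun x => ?_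
    simp only [hD, energyDeriv]
    set v := torusGrad ψ x + t • torusGrad η x with hv
    have h2 := hf.couplingPrim_add_le hq x (lam + t * μ + H x v) (lam + H x (torusGrad ψ x))
    have h3 := hH.add_inner_le x v (torusGrad ψ x)
    have h4 : torusGrad ψ x - v = -(t • torusGrad η x) := by rw [hv]; abel
    rw [h4, inner_neg_right, inner_smul_right] at h3
    have h5 := mul_le_mul_of_nonneg_left h3 (hf.couplingInv_nonneg hq x (lam + t * μ + H x v))
    nlinarith
  simp only [energy]
  linarith

theorem exists_abs_energyDeriv_le (hH : HamiltonianCond H r) (hr : 1 < r)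
    (hf : CouplingCond f q) (hq : 1 < q) (Λ : ℝ) :
    ∃ K, 0 < K ∧ ∀ (lam μ : ℝ) x v e, |lam| ≤ Λ → |energyDeriv H f lam μ x v e| ≤
      K * (|μ| + ‖e‖) * (1 + ‖v‖) ^ (q / (q - 1) * r - 1) := by
  obtain ⟨K₁, hK₁, h₁⟩ := exists_couplingInv_le hH hr hf hq Λ
  obtain ⟨K₂, hK₂, h₂⟩ := exists_couplingInv_smul_DpH_le hH hr hf hq Λ
  refine ⟨K₁ + K₂, by positivity, fun lam μ x v e hl => ?_⟩
  have hq0 : 0 < q - 1 := by linarith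
  have hv : 1 ≤ 1 + ‖v‖ := by linarith [norm_nonneg v]
  have hexp : r / (q - 1) ≤ q / (q - 1) * r - 1 := by
    have : q / (q - 1) * r - 1 = r / (q - 1) + (r - 1) := by field_simp; ring
    linarith
  set P := (1 + ‖v‖) ^ (q / (q - 1) * r - 1) with hP
  have hP0 : 0 ≤ P := by positivity
  set M := couplingInv f x (lam + H x v) with hM
  have hM0 : 0 ≤ M := hf.couplingInv_nonneg hq x _
  have h3 : M ≤ K₁ * P := (h₁ x v lam hl).trans
    (mul_le_mul_of_nonneg_left (Real.rpow_le_rpow_of_exponent_le hv hexp) hK₁.le)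
  have h4 : energyDeriv H f lam μ x v e = M * μ + inner ℝ (M • DpH H x v) e := by
    rw [energyDeriv, ← hM, real_inner_smul_left]; ring
  rw [h4]
  calc |M * μ + inner ℝ (M • DpH H x v) e| ≤ |M * μ| + |inner ℝ (M • DpH H x v) e| :=
        abs_add_le _ _
    _ ≤ K₁ * P * |μ| + K₂ * P * ‖e‖ := by
        gcongr
        · rw [abs_mul, abs_of_nonneg hM0]; gcongr
        · exact (abs_real_inner_le_norm _ _).trans (by gcongr; exact h₂ x v lam hl)
    _ ≤ (K₁ + K₂) * (|μ| + ‖e‖) * P := by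
        have h5 : 0 ≤ K₁ * P * ‖e‖ := by positivity
        have h6 : 0 ≤ K₂ * P * |μ| := by positivity
        nlinarith

end Energy

/-! ### Integrability of density and flux, and a Fatou lemma -/

section Integrability

variable {d : ℕ} {H : Torus d → Vec d → ℝ} {f : Torus d → ℝ → ℝ} {q r : ℝ}

theorem memLp_of_norm_le_rpow {Ω E F : Type*} [MeasurableSpace Ω] {μ : Measure Ω}
    [IsFiniteMeasure μ] [NormedAddCommGroup E] [NormedAddCommGroup F] {s b K : ℝ} (hb : 0 < b)
    {g : Ω → E} (hg : MemLp g (ENNReal.ofReal s) μ) {u : Ω → F}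
    (hu : AEStronglyMeasurable u μ) (h : ∀ x, ‖u x‖ ≤ K * (1 + ‖g x‖) ^ b) :
    MemLp u (ENNReal.ofReal (s / b)) μ := by
  have h1 : MemLp (fun x => 1 + ‖g x‖) (ENNReal.ofReal s) μ :=
    MemLp.add (f := fun _ => (1 : ℝ)) (memLp_const 1) hg.norm
  have h2 := (h1.norm_rpow_div (ENNReal.ofReal b)).const_mul K
  rw [ENNReal.toReal_ofReal hb.le, ← ENNReal.ofReal_div_of_pos hb] at h2
  refine h2.mono' hu (Eventually.of_forall fun x => ?_)
  have h3 := h x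
  rwa [Real.norm_of_nonneg (by positivity)]

theorem aestronglyMeasurable_couplingInv (hH : HamiltonianCond H r) (hf : CouplingCond f q)
    (hq : 1 < q) (lam : ℝ) {g : Torus d → Vec d} (hg : AEStronglyMeasurable g volume) :
    AEStronglyMeasurable (fun x => couplingInv f x (lam + H x (g x))) volume := by
  have hc : Continuous fun z : Torus d × Vec d => couplingInv f z.1 (lam + H z.1 z.2) :=
    hf.continuous_couplingInv_comp hq continuous_fst (continuous_const.add hH.continuous)
  exact hc.comp_aestronglyMeasurable (aestronglyMeasurable_id.prodMk hg)

theorem memLp_couplingInv (hH : HamiltonianCond H r) (hr : 1 < r) (hf : CouplingCond f q)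
    (hq : 1 < q) (lam : ℝ) {g : Torus d → Vec d}
    (hg : MemLp g (ENNReal.ofReal (q / (q - 1) * r)) volume) :
    MemLp (fun x => couplingInv f x (lam + H x (g x))) (ENNReal.ofReal q) volume := by
  obtain ⟨K, hK, h⟩ := exists_couplingInv_le hH hr hf hq |lam|
  have hq0 : 0 < q - 1 := by linarith
  have h1 := memLp_of_norm_le_rpow (b := r / (q - 1)) (K := K) (by positivity) hg
    (aestronglyMeasurable_couplingInv hH hf hq lam hg.1) fun x => by
      rw [Real.norm_of_nonneg (hf.couplingInv_nonneg hq x _)]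
      exact h x (g x) lam le_rfl
  have e : q / (q - 1) * r / (r / (q - 1)) = q := by field_simp
  rwa [e] at h1

theorem memLp_couplingInv_smul_DpH (hH : HamiltonianCond H r) (hr : 1 < r)
    (hf : CouplingCond f q) (hq : 1 < q) (lam : ℝ) {g : Torus d → Vec d}
    (hg : MemLp g (ENNReal.ofReal (q / (q - 1) * r)) volume) :
    MemLp (fun x => couplingInv f x (lam + H x (g x)) • DpH H x (g x))
      (ENNReal.ofReal (Real.conjExponent (q / (q - 1) * r))) volume := by
  obtain ⟨K, hK, h⟩ := exists_couplingInv_smul_DpH_le hH hr hf hq |lam|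
  have hq0 : 0 < q - 1 := by linarith
  have hp : 1 < q / (q - 1) := by rw [lt_div_iff₀ hq0]; linarith
  have hs : 1 < q / (q - 1) * r := by nlinarith
  exact memLp_of_norm_le_rpow (K := K) (by linarith) hg
    ((aestronglyMeasurable_couplingInv hH hf hq lam hg.1).smul
      (hH.continuous_DpH.comp_aestronglyMeasurable (aestronglyMeasurable_id.prodMk hg.1)))
    fun x => h x (g x) lam le_rfl

/-- A form of **Fatou's lemma** for real integrals. -/
theorem integral_le_of_tendsto_ae {Ω : Type*} [MeasurableSpace Ω] {μ : Measure Ω}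
    {F : ℕ → Ω → ℝ} {G : Ω → ℝ} {c : ℕ → ℝ} {c₀ : ℝ} (hF : ∀ n, Integrable (F n) μ)
    (hF0 : ∀ n x, 0 ≤ F n x) (hG : AEStronglyMeasurable G μ)
    (hlim : ∀ᵐ x ∂μ, Tendsto (fun n => F n x) atTop (𝓝 (G x)))
    (hc : ∀ n, ∫ x, F n x ∂μ ≤ c n) (hc₀ : Tendsto c atTop (𝓝 c₀)) : ∫ x, G x ∂μ ≤ c₀ := by
  have hG0 : ∀ᵐ x ∂μ, 0 ≤ G x := hlim.mono fun x hx => ge_of_tendsto' hx fun n => hF0 n x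
  have hc0 : 0 ≤ c₀ := ge_of_tendsto' hc₀ fun n => (integral_nonneg (hF0 n)).trans (hc n)
  rw [integral_eq_lintegral_of_nonneg_ae hG0 hG]
  refine ENNReal.toReal_le_of_le_ofReal hc0 ?_
  calc ∫⁻ x, ENNReal.ofReal (G x) ∂μ
      = ∫⁻ x, liminf (fun n => ENNReal.ofReal (F n x)) atTop ∂μ :=
        lintegral_congr_ae (hlim.mono fun x hx => (ENNReal.tendsto_ofReal hx).liminf_eq.symm)
    _ ≤ liminf (fun n => ∫⁻ x, ENNReal.ofReal (F n x) ∂μ) atTop :=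
        lintegral_liminf_le' fun n => (hF n).1.aemeasurable.ennreal_ofReal
    _ ≤ liminf (fun n => ENNReal.ofReal (c n)) atTop := by
        refine liminf_le_liminf (Eventually.of_forall fun n => ?_)
        rw [← ofReal_integral_eq_lintegral_ofReal (hF n) (Eventually.of_forall (hF0 n))]
        exact ENNReal.ofReal_le_ofReal (hc n)
    _ = ENNReal.ofReal c₀ := (ENNReal.tendsto_ofReal hc₀).liminf_eq

end Integrability

/-! ### Existence: strong convergence and the Euler-Lagrange equations -/

section Existence

variable {d : ℕ} {H : Torus d → Vec d → ℝ} {f : Torus d → ℝ → ℝ} {q r : ℝ}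

theorem one_lt_exponent (hq : 1 < q) (hr : 1 < r) : 1 < q / (q - 1) * r := by
  have hq0 : 0 < q - 1 := by linarith
  have hp : 1 < q / (q - 1) := by rw [lt_div_iff₀ hq0]; linarith
  nlinarith

/-- There is a minimizing sequence of the energy whose gradients converge strongly. -/
theorem exists_convergent_minimizing_seq (hH : HamiltonianCond H r) (hr : 1 < r)
    (hf : CouplingCond f q) (hq : 1 < q) :
    ∃ (lam Λ B : ℝ) (φ : Torus d → ℝ) (g : Torus d → Vec d) (l : ℕ → ℝ) (ψ : ℕ → Torus d → ℝ),
      HasSobolevGrad (ENNReal.ofReal (q / (q - 1) * r)) φ g ∧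
      (∀ n, SmoothOnTorus (ψ n)) ∧ (∀ n, |l n| ≤ Λ) ∧
      (∀ n, ∫ x, ‖torusGrad (ψ n) x‖ ^ (q / (q - 1) * r) ≤ B) ∧
      (∀ n (l' : ℝ) η, SmoothOnTorus η →
        energy H f (l n) (ψ n) ≤ energy H f l' η + 1 / ((n : ℝ) + 1)) ∧
      Tendsto l atTop (𝓝 lam) ∧
      ∀ᵐ x, Tendsto (fun n => torusGrad (ψ n) x) atTop (𝓝 (g x)) := by
  set s := q / (q - 1) * r with hs
  have hs1 : 1 < s := one_lt_exponent hq hr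
  obtain ⟨K, hK⟩ := exists_abs_le_energy hH hr hf hq
  obtain ⟨c, z, δ, hzA, hzc, hzmin, hδ, hgap⟩ := exists_minimizing_seq
    (X := ℝ × (Torus d → ℝ)) (A := {z | SmoothOnTorus z.2})
    ⟨(0, fun _ => 0), SmoothOnTorus.const 0⟩
    (fun z w => ((z.1 + w.1) / 2, fun x => 1 / 2 * (z.2 x + w.2 x)))
    (fun z hz w hw => SmoothOnTorus.midpoint hz hw)
    (J := fun z => energy H f z.1 z.2) (N := fun z => ∫ x, ‖torusGrad z.2 x‖ ^ s)
    (fun z hz w hw => energy_midpoint_le hH hf hq z.1 w.1 hz hw)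
    (b := -K) (fun z hz => by linarith [hK z.1 z.2 hz, abs_nonneg z.1])
    (fun z _ => by positivity)
    (fun c => by
      obtain ⟨_, B, hB⟩ := exists_integral_norm_rpow_le hH hr hf hq c
      exact ⟨B, fun z hz hzc => (hB z.1 z.2 hz hzc).2⟩)
  obtain ⟨Λ, B, hB⟩ := exists_integral_norm_rpow_le hH hr hf hq c
  have hΛ := fun n => (hB _ _ (hzA n) (hzc n)).1
  have hBn := fun n => (hB _ _ (hzA n) (hzc n)).2
  have hgc : ∀ n, Continuous (torusGrad (z n).2) := fun n =>
    SmoothOnTorus.continuous_torusGrad (hzA n)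
  have hint : ∀ {F : Torus d → Vec d}, Continuous F → Integrable fun x => ‖F x‖ ^ s := fun hF =>
    integrable_of_continuous (hF.norm.rpow_const fun _ => Or.inr (by linarith))
  have hcau : ∀ ε > 0, ∃ N, ∀ n ≥ N,
      ∫ x, ‖torusGrad (z n).2 x - torusGrad (z N).2 x‖ ^ s ≤ ε := by
    intro ε hε
    have hB0 : 0 ≤ B := le_trans (by positivity) (hBn 0)
    -- The parameter is chosen so that the bounded norms contribute at most `ε / 2`; the convexity
    -- gap, made smaller than `ε / (2 * L)`, contributes the other half.
    obtain ⟨L, hL, hL'⟩ := exists_norm_sub_rpow_le (E := Vec d) hs1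
      (ε := ε / (4 * (B + 1))) (by positivity)
    obtain ⟨N, hN⟩ := (hδ.eventually (gt_mem_nhds (by positivity : 0 < ε / (2 * L)))).exists
    refine ⟨N, fun n hn => ?_⟩
    have iN := hint (hgc N)
    have iN' := hint (hgc n)
    have im : Integrable fun x =>
        ‖(1 / 2 : ℝ) • (torusGrad (z N).2 x + torusGrad (z n).2 x)‖ ^ s :=
      hint (((hgc N).add (hgc n)).const_smul (1 / 2 : ℝ))
    have iS : Integrable fun x => ‖torusGrad (z N).2 x‖ ^ s + ‖torusGrad (z n).2 x‖ ^ s :=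
      iN.add iN'
    have iG : Integrable fun x => (‖torusGrad (z N).2 x‖ ^ s + ‖torusGrad (z n).2 x‖ ^ s) / 2 -
        ‖(1 / 2 : ℝ) • (torusGrad (z N).2 x + torusGrad (z n).2 x)‖ ^ s := (iS.div_const 2).sub im
    have h1 := hgap N n hn
    simp only [torusGrad_midpoint (hzA N) (hzA n)] at h1
    have h2 : ∫ x, ‖torusGrad (z n).2 x - torusGrad (z N).2 x‖ ^ s ≤
        ∫ x, (ε / (4 * (B + 1)) * (‖torusGrad (z N).2 x‖ ^ s + ‖torusGrad (z n).2 x‖ ^ s) +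
          L * ((‖torusGrad (z N).2 x‖ ^ s + ‖torusGrad (z n).2 x‖ ^ s) / 2 -
            ‖(1 / 2 : ℝ) • (torusGrad (z N).2 x + torusGrad (z n).2 x)‖ ^ s)) := by
      refine integral_mono (hint ((hgc n).sub (hgc N))) ((iS.const_mul _).add (iG.const_mul L)) fun x => ?_
      have := hL' (torusGrad (z N).2 x) (torusGrad (z n).2 x)
      rwa [norm_sub_rev] at this
    have e1 : ∫ x, (‖torusGrad (z N).2 x‖ ^ s + ‖torusGrad (z n).2 x‖ ^ s) =
      (∫ x, ‖torusGrad (z N).2 x‖ ^ s) + ∫ x, ‖torusGrad (z n).2 x‖ ^ s := integral_add iN iN'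
    have e2 : ∫ x, ((‖torusGrad (z N).2 x‖ ^ s + ‖torusGrad (z n).2 x‖ ^ s) / 2 -
            ‖(1 / 2 : ℝ) • (torusGrad (z N).2 x + torusGrad (z n).2 x)‖ ^ s) =
        ((∫ x, ‖torusGrad (z N).2 x‖ ^ s) + ∫ x, ‖torusGrad (z n).2 x‖ ^ s) / 2 -
          ∫ x, ‖(1 / 2 : ℝ) • (torusGrad (z N).2 x + torusGrad (z n).2 x)‖ ^ s := by
      rw [integral_sub (iS.div_const 2) im, integral_div, e1]
    rw [integral_add (iS.const_mul _) (iG.const_mul L), integral_const_mul, integral_const_mul,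
      e1, e2] at h2
    refine h2.trans ?_
    have h3 : ε / (4 * (B + 1)) * ((∫ x, ‖torusGrad (z N).2 x‖ ^ s) +
        ∫ x, ‖torusGrad (z n).2 x‖ ^ s) ≤ ε / 2 := by
      calc _ ≤ ε / (4 * (B + 1)) * ((B + 1) + (B + 1)) := by
            gcongr
            · linarith [hBn N]
            · linarith [hBn n]
        _ = ε / 2 := by field_simp; ring
    have h4 := mul_le_mul_of_nonneg_left (h1.trans hN.le) hL.le
    have e3 : L * (ε / (2 * L)) = ε / 2 := by field_simp
    linarith
  obtain ⟨φ, g, hφg, hlim⟩ := exists_hasSobolevGrad_of_cauchy hs1.le hzA hcau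
  obtain ⟨k, hk, hkae⟩ := (tendstoInMeasure_of_tendsto_eLpNorm (by simp; linarith)
    (fun n => (hgc n).aestronglyMeasurable) hφg.memLp_grad.1 hlim).exists_seq_tendsto_ae
  obtain ⟨lam, -, k', hk', hlam⟩ := tendsto_subseq_of_bounded (Metric.isBounded_Icc (-Λ) Λ)
    (x := fun n => (z (k n)).1) fun n => abs_le.1 (hΛ (k n))
  have hkk : StrictMono (k ∘ k') := hk.comp hk'
  refine ⟨lam, Λ, B, φ, g, fun n => (z (k (k' n))).1, fun n => (z (k (k' n))).2, hφg,
    fun n => hzA _, fun n => hΛ _, fun n => hBn _, fun n l' η hη => ?_, hlam,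
    hkae.mono fun x hx => hx.comp hk'.tendsto_atTop⟩
  refine (hzmin _ (l', η) hη).trans ?_
  -- Passing to a subsequence only improves the minimality defect.
  have : (n : ℝ) ≤ (k (k' n) : ℝ) := by exact_mod_cast hkk.id_le n
  simp only
  gcongr

/-- Existence of a critical point of the energy. -/
theorem exists_critical_point (hH : HamiltonianCond H r) (hr : 1 < r)
    (hf : CouplingCond f q) (hq : 1 < q) :
    ∃ (lam : ℝ) (φ : Torus d → ℝ) (g : Torus d → Vec d),
      HasSobolevGrad (ENNReal.ofReal (q / (q - 1) * r)) φ g ∧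
      ∀ (μ : ℝ) (η : Torus d → ℝ), SmoothOnTorus η →
        μ ≤ ∫ x, energyDeriv H f lam μ x (g x) (torusGrad η x) := by
  obtain ⟨lam, Λ, B, φ, g, l, ψ, hφg, hψ, hl, hB, hmin, hlam, hg⟩ :=
    exists_convergent_minimizing_seq hH hr hf hq
  refine ⟨lam, φ, g, hφg, fun μ η hη => ?_⟩
  set s := q / (q - 1) * r with hs
  have hs1 : 1 < s := one_lt_exponent hq hr
  have hs0 : 0 < s := by linarith
  obtain ⟨D, hD⟩ := (isCompact_range hη.continuous_torusGrad.norm).bddAbove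
  have hD' : ∀ x, ‖torusGrad η x‖ ≤ D := fun x => hD (mem_range_self x)
  have hD0 : 0 ≤ D := (norm_nonneg _).trans (hD' 0)
  obtain ⟨K, hK, hK'⟩ := exists_abs_energyDeriv_le hH hr hf hq (Λ + |μ|)
  set K₁ := K * (|μ| + D) with hK₁
  have hK₁0 : 0 ≤ K₁ := by positivity
  -- the steps and the perturbed gradients
  set t : ℕ → ℝ := fun n => 1 / √((n : ℝ) + 1) with ht
  have ht0 : ∀ n, 0 < t n := fun n => by positivity
  have ht1 : ∀ n, t n ≤ 1 := fun n => by
    rw [ht]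
    simp only
    rw [div_le_one (by positivity), Real.one_le_sqrt]
    linarith [(Nat.cast_nonneg n : (0 : ℝ) ≤ n)]
  -- The step is the square root of the minimality defect: dividing the first-order inequality by `t
  -- n` leaves an error `t n`, which still tends to zero.
  have htsq : ∀ n : ℕ, 1 / ((n : ℝ) + 1) = t n * t n := fun n => by
    simp only [ht]
    rw [div_mul_div_comm, Real.mul_self_sqrt (by positivity), one_mul]
  have htlim : Tendsto t atTop (𝓝 0) := by
    have h1 := (tendsto_one_div_add_atTop_nhds_zero_nat (𝕜 := ℝ)).sqrt
    simp only [Real.sqrt_zero] at h1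
    refine h1.congr fun n => ?_
    rw [Real.sqrt_div zero_le_one, Real.sqrt_one]
  set v : ℕ → Torus d → Vec d := fun n x => torusGrad (ψ n) x + t n • torusGrad η x with hv
  have hvc : ∀ n, Continuous (v n) := fun n =>
    (hψ n).continuous_torusGrad.add (hη.continuous_torusGrad.const_smul (t n))
  set b : ℕ → Torus d → ℝ := fun n x =>
    energyDeriv H f (l n + t n * μ) μ x (v n x) (torusGrad η x) with hb
  have hbc : ∀ n, Continuous (b n) := fun n => (continuous_energyDeriv hH hf hq μ).comp
    (continuous_const.prodMk (continuous_id.prodMk ((hvc n).prodMk hη.continuous_torusGrad)))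
  have hb_int : ∀ n, μ - t n ≤ ∫ x, b n x := fun n => by
    have h1 := energy_sub_le hH hf hq (l n) μ (t := t n) (hψ n) hη
    have h2 := hmin n (l n + t n * μ) _ ((hψ n).add (hη.const_mul (t n)))
    rw [htsq] at h2
    have h3 : t n * (-t n) ≤ t n * ((∫ x, b n x) - μ) := by simp only [hb, hv]; linarith
    linarith [le_of_mul_le_mul_left h3 (ht0 n)]
  have hbound : ∀ (l' : ℝ) x w, |l'| ≤ Λ + |μ| →
      |energyDeriv H f l' μ x w (torusGrad η x)| ≤ K₁ * (1 + ‖w‖) ^ (s - 1) := fun l' x w h => by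
    refine (hK' l' μ x w (torusGrad η x) h).trans ?_
    rw [hK₁]
    gcongr
    exact hD' x
  have hlt : ∀ n, |l n + t n * μ| ≤ Λ + |μ| := fun n => by
    refine (abs_add_le _ _).trans (add_le_add (hl n) ?_)
    rw [abs_mul, abs_of_pos (ht0 n)]
    exact mul_le_of_le_one_left (abs_nonneg μ) (ht1 n)
  have hlamΛ : |lam| ≤ Λ + |μ| :=
    (le_of_tendsto' hlam.abs hl).trans (le_add_of_nonneg_right (abs_nonneg μ))
  -- a uniform bound on the perturbed gradients
  set B' : ℝ := 2 ^ s * ((1 + D) ^ s + B) with hB'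
  have hvB : ∀ n, ∫ x, (1 + ‖v n x‖) ^ s ≤ B' := fun n => by
    have iψ : Integrable fun x => ‖torusGrad (ψ n) x‖ ^ s := integrable_of_continuous
      ((hψ n).continuous_torusGrad.norm.rpow_const fun _ => Or.inr hs0.le)
    have h1 : ∫ x, (1 + ‖v n x‖) ^ s ≤ ∫ x, 2 ^ s * ((1 + D) ^ s + ‖torusGrad (ψ n) x‖ ^ s) := by
      refine integral_mono (integrable_of_continuous ((continuous_const.add
        (hvc n).norm).rpow_const fun _ => Or.inr hs0.le))
        (((integrable_const _).add iψ).const_mul _) fun x => ?_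
      have h2 : ‖v n x‖ ≤ ‖torusGrad (ψ n) x‖ + D := by
        refine (norm_add_le _ _).trans (add_le_add le_rfl ?_)
        rw [norm_smul, Real.norm_of_nonneg (ht0 n).le]
        exact (mul_le_of_le_one_left (norm_nonneg _) (ht1 n)).trans (hD' x)
      have h3 : 1 + ‖v n x‖ ≤ 2 * max (1 + D) ‖torusGrad (ψ n) x‖ := by
        linarith [le_max_left (1 + D) ‖torusGrad (ψ n) x‖,
          le_max_right (1 + D) ‖torusGrad (ψ n) x‖]
      refine (Real.rpow_le_rpow (by positivity) h3 hs0.le).trans ?_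
      rw [Real.mul_rpow (by norm_num) (le_max_of_le_left (by positivity))]
      refine mul_le_mul_of_nonneg_left ?_ (by positivity)
      have p1 : 0 ≤ (1 + D) ^ s := by positivity
      have p2 : 0 ≤ ‖torusGrad (ψ n) x‖ ^ s := by positivity
      rcases max_choice (1 + D) ‖torusGrad (ψ n) x‖ with e | e <;> rw [e] <;> linarith
    rw [integral_const_mul, integral_add (integrable_const _) iψ, integral_const, probReal_univ,
      one_smul] at h1
    refine h1.trans ?_
    rw [hB']
    gcongr
    exact hB n
  -- the limit
  have hbm : AEStronglyMeasurable (fun x => energyDeriv H f lam μ x (g x) (torusGrad η x))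
      volume :=
    (continuous_energyDeriv hH hf hq μ).comp_aestronglyMeasurable
      (aestronglyMeasurable_const.prodMk (aestronglyMeasurable_id.prodMk
        (hφg.memLp_grad.1.prodMk hη.continuous_torusGrad.aestronglyMeasurable)))
  have hgs : MemLp (fun x => 1 + ‖g x‖) (ENNReal.ofReal s) volume :=
    MemLp.add (f := fun _ => (1 : ℝ)) (memLp_const 1) hφg.memLp_grad.norm
  have igs : Integrable fun x => (1 + ‖g x‖) ^ s := by
    have h1 := hgs.integrable_norm_rpow (by simpa using hs0) ENNReal.ofReal_ne_top
    rw [ENNReal.toReal_ofReal hs0.le] at h1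
    refine h1.congr (Eventually.of_forall fun x => ?_)
    simp only
    rw [Real.norm_of_nonneg (by positivity)]
  have iB : Integrable fun x => energyDeriv H f lam μ x (g x) (torusGrad η x) := by
    refine (igs.const_mul K₁).mono' hbm (Eventually.of_forall fun x => ?_)
    refine (hbound lam x (g x) hlamΛ).trans (mul_le_mul_of_nonneg_left ?_ hK₁0)
    exact Real.rpow_le_rpow_of_exponent_le (by linarith [norm_nonneg (g x)]) (by linarith)
  have hae : ∀ᵐ x, Tendsto (fun n => v n x) atTop (𝓝 (g x)) := hg.mono fun x hx => by
    simpa using hx.add (htlim.smul_const (torusGrad η x))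
  -- The derivative has order `s - 1`, so an arbitrarily small multiple of the `s`-th power, plus a
  -- constant, dominates it. The difference is nonnegative, as Fatou's lemma requires, and the cost
  -- is at most `K₁ * (κ * B')`, which disappears as `κ → 0`.
  have hyoung : ∀ κ > 0, ∀ w : ℝ, 1 ≤ w → w ^ (s - 1) ≤ κ * w ^ s + κ⁻¹ ^ (s - 1) := by
    intro κ hκ w hw
    have hw0 : 0 < w := by linarith
    rcases le_total w κ⁻¹ with h | h
    · have h1 : w ^ (s - 1) ≤ κ⁻¹ ^ (s - 1) := Real.rpow_le_rpow hw0.le h (by linarith)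
      have h2 : 0 ≤ κ * w ^ s := by positivity
      linarith
    · have h1 : w ^ s = w ^ (s - 1) * w := by
        rw [← Real.rpow_add_one hw0.ne', sub_add_cancel]
      have h2 : 1 ≤ κ * w := by
        have := mul_le_mul_of_nonneg_left h hκ.le
        rwa [mul_inv_cancel₀ hκ.ne'] at this
      have h3 : 0 ≤ w ^ (s - 1) := by positivity
      have h4 : (0 : ℝ) ≤ κ⁻¹ ^ (s - 1) := by positivity
      rw [h1]
      nlinarith
  have key : ∀ κ > 0, μ ≤ (∫ x, energyDeriv H f lam μ x (g x) (torusGrad η x)) +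
      K₁ * (κ * B') := by
    intro κ hκ
    set Cκ : ℝ := κ⁻¹ ^ (s - 1)
    have iv : ∀ n, Integrable fun x => (1 + ‖v n x‖) ^ s := fun n => integrable_of_continuous
      ((continuous_const.add (hvc n).norm).rpow_const fun _ => Or.inr hs0.le)
    have i1 : ∀ n, Integrable fun x => K₁ * (κ * (1 + ‖v n x‖) ^ s + Cκ) := fun n =>
      (((iv n).const_mul κ).add (integrable_const Cκ)).const_mul K₁
    have i2 : Integrable fun x => K₁ * (κ * (1 + ‖g x‖) ^ s + Cκ) :=
      ((igs.const_mul κ).add (integrable_const Cκ)).const_mul K₁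
    have h1 : ∫ x, (K₁ * (κ * (1 + ‖g x‖) ^ s + Cκ) -
        energyDeriv H f lam μ x (g x) (torusGrad η x)) ≤ K₁ * (κ * B' + Cκ) - (μ - 0) := by
      refine integral_le_of_tendsto_ae
        (F := fun n x => K₁ * (κ * (1 + ‖v n x‖) ^ s + Cκ) - b n x)
        (c := fun n => K₁ * (κ * B' + Cκ) - (μ - t n))
        (fun n => (i1 n).sub (integrable_of_continuous (hbc n))) (fun n x => ?_)
        (i2.sub iB).1 (hae.mono fun x hx => ?_) (fun n => ?_)
        (tendsto_const_nhds.sub (tendsto_const_nhds.sub htlim))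
      · have h2 := (le_abs_self _).trans (hbound _ x (v n x) (hlt n))
        have h3 := mul_le_mul_of_nonneg_left
          (hyoung κ hκ (1 + ‖v n x‖) (by linarith [norm_nonneg (v n x)])) hK₁0
        simp only [hb]
        linarith
      · refine Tendsto.sub ?_ ?_
        · refine Tendsto.const_mul _ (Tendsto.add_const _ (Tendsto.const_mul _ ?_))
          exact (hx.norm.const_add 1).rpow_const (Or.inr hs0.le)
        · have h2 : Tendsto (fun n => l n + t n * μ) atTop (𝓝 lam) := by
            simpa using hlam.add (htlim.mul_const μ)
          exact ((continuous_energyDeriv hH hf hq μ).tendsto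
            (lam, x, g x, torusGrad η x)).comp
            (h2.prodMk_nhds (tendsto_const_nhds.prodMk_nhds (hx.prodMk_nhds tendsto_const_nhds)))
      · rw [integral_sub (i1 n) (integrable_of_continuous (hbc n)), integral_const_mul,
          integral_add ((iv n).const_mul κ) (integrable_const Cκ), integral_const_mul,
          integral_const, probReal_univ, one_smul]
        have h2 : K₁ * (κ * (∫ x, (1 + ‖v n x‖) ^ s) + Cκ) ≤ K₁ * (κ * B' + Cκ) := by
          gcongr
          exact hvB n
        linarith [hb_int n]
    rw [integral_sub i2 iB, integral_const_mul, integral_add (igs.const_mul κ)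
      (integrable_const Cκ), integral_const_mul, integral_const, probReal_univ, one_smul] at h1
    have h2 : 0 ≤ K₁ * (κ * ∫ x, (1 + ‖g x‖) ^ s) := by positivity
    linarith
  refine le_of_forall_pos_le_add fun ε hε => ?_
  have hB'0 : 0 ≤ B' := le_trans (by positivity) (hvB 0)
  have h1 := key (ε / (K₁ * B' + 1)) (by positivity)
  have h2 : K₁ * (ε / (K₁ * B' + 1) * B') ≤ ε := by
    have e : K₁ * (ε / (K₁ * B' + 1) * B') = ε * (K₁ * B') / (K₁ * B' + 1) := by ring
    rw [e, div_le_iff₀ (by positivity)]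
    nlinarith
  linarith

/-- Existence of a weak solution of the ergodic mean field game system. -/
theorem exists_isWeakSolution (hH : HamiltonianCond H r) (hr : 1 < r)
    (hf : CouplingCond f q) (hq : 1 < q) : ∃ lam φ m, IsWeakSolution H f q r lam φ m := by
  obtain ⟨lam, φ, g, hφg, hcrit⟩ := exists_critical_point hH hr hf hq
  have hs1 : 1 < q / (q - 1) * r := one_lt_exponent hq hr
  set M : Torus d → ℝ := fun x => couplingInv f x (lam + H x (g x)) with hM
  have hMq : MemLp M (ENNReal.ofReal q) volume := memLp_couplingInv hH hr hf hq lam hφg.memLp_grad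
  have hflux := memLp_couplingInv_smul_DpH hH hr hf hq lam hφg.memLp_grad
  have hconj : 1 ≤ ENNReal.ofReal (Real.conjExponent (q / (q - 1) * r)) := by
    have := (Real.HolderConjugate.conjExponent hs1).symm.lt.le
    simpa using this
  have iM : Integrable M := hMq.integrable (by simpa using hq.le)
  have hflux_int : Integrable fun x => M x • DpH H x (g x) := hflux.integrable hconj
  have i2 : ∀ η : Torus d → ℝ, SmoothOnTorus η →
      Integrable fun x => inner ℝ (M x • DpH H x (g x)) (torusGrad η x) := fun η hη => by
    obtain ⟨D, hD⟩ := (isCompact_range hη.continuous_torusGrad.norm).bddAbove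
    refine (hflux_int.norm.mul_const D).mono'
      (hflux_int.1.inner hη.continuous_torusGrad.aestronglyMeasurable)
      (Eventually.of_forall fun x => (norm_inner_le_norm _ _).trans ?_)
    gcongr
    exact hD (mem_range_self x)
  have key : ∀ (μ : ℝ) (η : Torus d → ℝ), SmoothOnTorus η →
      μ ≤ μ * (∫ x, M x) + ∫ x, inner ℝ (M x • DpH H x (g x)) (torusGrad η x) := by
    intro μ η hη
    refine (hcrit μ η hη).trans_eq ?_
    rw [← integral_const_mul, ← integral_add (iM.const_mul μ) (i2 η hη)]
    congr 1 with x
    rw [energyDeriv, real_inner_smul_left]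
    ring
  refine ⟨lam, φ, M, g, hφg, hMq, Eventually.of_forall fun x => hf.couplingInv_nonneg hq x _, ?_,
    hflux_int, Eventually.of_forall fun x hx => (hf.apply_couplingInv hq hx).symm,
    Eventually.of_forall fun x => hf.le_couplingExt_couplingInv hq x _, fun η hη => ?_⟩
  · have h1 := key 1 (fun _ => 0) (SmoothOnTorus.const 0)
    have h2 := key (-1) (fun _ => 0) (SmoothOnTorus.const 0)
    simp only [torusGrad_const, inner_zero_right, integral_zero] at h1 h2
    linarith
  · have h1 := key 0 η hη
    have h2 := key 0 _ (hη.const_mul (-1))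
    simp only [torusGrad_const_mul hη, neg_one_smul, inner_neg_right, integral_neg] at h2
    linarith

end Existence

/-! ### Testing divergence-free fields against weak gradients by Fourier analysis -/

section Fourier

open UnitAddTorus

variable {d : ℕ}

/-- The frequency vector `2 π n`. -/
noncomputable def frequency (n : Fin d → ℤ) : Vec d := WithLp.toLp 2 fun i => 2 * Real.pi * n i

theorem mFourier_toTorus (n : Fin d → ℤ) (v : Vec d) :
    mFourier n (toTorus v) = Complex.exp ((inner ℝ (frequency n) v : ℝ) * Complex.I) := by
  have h1 : mFourier n (toTorus v) = ∏ i, Complex.exp (2 * Real.pi * Complex.I * n i * v i) := by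
    change ∏ i, fourier (n i) ((v i : ℝ) : UnitAddCircle) = _
    refine Finset.prod_congr rfl fun i _ => ?_
    rw [fourier_coe_apply]
    simp
  rw [h1, ← Complex.exp_sum]
  congr 1
  simp only [frequency, PiLp.inner_apply, Complex.ofReal_sum, Finset.sum_mul]
  refine Finset.sum_congr rfl fun i _ => ?_
  simp
  ring

theorem mFourier_add_toTorus_re (n : Fin d → ℤ) (w v : Vec d) :
    (mFourier n (toTorus w + toTorus v)).re = Real.cos (inner ℝ (frequency n) (w + v)) := by
  rw [← toTorus_add, mFourier_toTorus, Complex.exp_ofReal_mul_I_re]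

theorem mFourier_add_toTorus_im (n : Fin d → ℤ) (w v : Vec d) :
    (mFourier n (toTorus w + toTorus v)).im = Real.sin (inner ℝ (frequency n) (w + v)) := by
  rw [← toTorus_add, mFourier_toTorus, Complex.exp_ofReal_mul_I_im]

theorem smoothOnTorus_mFourier_re (n : Fin d → ℤ) : SmoothOnTorus fun x => (mFourier n x).re := by
  have h : (fun v : Vec d => (mFourier n (toTorus v)).re) =
      fun v => Real.cos (inner ℝ (frequency n) v) := by
    funext v; rw [mFourier_toTorus, Complex.exp_ofReal_mul_I_re]
  rw [SmoothOnTorus, h]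
  exact Real.contDiff_cos.comp (contDiff_const.inner ℝ contDiff_id)

theorem smoothOnTorus_mFourier_im (n : Fin d → ℤ) : SmoothOnTorus fun x => (mFourier n x).im := by
  have h : (fun v : Vec d => (mFourier n (toTorus v)).im) =
      fun v => Real.sin (inner ℝ (frequency n) v) := by
    funext v; rw [mFourier_toTorus, Complex.exp_ofReal_mul_I_im]
  rw [SmoothOnTorus, h]
  exact Real.contDiff_sin.comp (contDiff_const.inner ℝ contDiff_id)

theorem hasFDerivAt_inner_add (N w : Vec d) :
    HasFDerivAt (fun v : Vec d => inner ℝ N (w + v)) (InnerProductSpace.toDual ℝ (Vec d) N) 0 := by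
  have h1 : (fun v : Vec d => inner ℝ N (w + v)) =
      fun v => inner ℝ N w + InnerProductSpace.toDual ℝ (Vec d) N v := by
    funext v; rw [inner_add_right, InnerProductSpace.toDual_apply_apply]
  rw [h1]
  exact (ContinuousLinearMap.hasFDerivAt _).const_add _

theorem torusGrad_mFourier_re (n : Fin d → ℤ) (x : Torus d) :
    torusGrad (fun x => (mFourier n x).re) x = -(mFourier n x).im • frequency n := by
  obtain ⟨w, rfl⟩ := toTorus_surjective x
  refine (smoothOnTorus_mFourier_re n).torusGrad_eq ?_
  simp only [mFourier_add_toTorus_re]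
  rw [hasGradientAt_iff_hasFDerivAt]
  have h1 := (hasFDerivAt_inner_add (frequency n) w).cos
  rw [add_zero] at h1
  rw [map_smulₛₗ, mFourier_toTorus, Complex.exp_ofReal_mul_I_im]
  exact h1

theorem torusGrad_mFourier_im (n : Fin d → ℤ) (x : Torus d) :
    torusGrad (fun x => (mFourier n x).im) x = (mFourier n x).re • frequency n := by
  obtain ⟨w, rfl⟩ := toTorus_surjective x
  refine (smoothOnTorus_mFourier_im n).torusGrad_eq ?_
  simp only [mFourier_add_toTorus_im]
  rw [hasGradientAt_iff_hasFDerivAt]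
  have h1 := (hasFDerivAt_inner_add (frequency n) w).sin
  rw [add_zero] at h1
  rw [map_smulₛₗ, mFourier_toTorus, Complex.exp_ofReal_mul_I_re]
  exact h1

theorem mFourier_sub (n : Fin d → ℤ) (x y : Torus d) :
    mFourier n (y - x) = mFourier n y * starRingEnd ℂ (mFourier n x) := by
  obtain ⟨v, rfl⟩ := toTorus_surjective x
  obtain ⟨w, rfl⟩ := toTorus_surjective y
  have h : toTorus w - toTorus v = toTorus (w - v) := by
    rw [sub_eq_iff_eq_add, ← toTorus_add, sub_add_cancel]
  rw [h, mFourier_toTorus, mFourier_toTorus, mFourier_toTorus, ← Complex.exp_conj,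
    ← Complex.exp_add, inner_sub_right]
  congr 1
  simp
  ring

/-- A continuous real function on the torus which is orthogonal to all characters vanishes. -/
theorem eq_zero_of_integral_mFourier_eq_zero {u : Torus d → ℝ} (hu : Continuous u)
    (h : ∀ n : Fin d → ℤ, ∫ x, (u x : ℂ) * mFourier n x = 0) : u = 0 := by
  have hint : ∀ F : C(Torus d, ℂ), Integrable fun x => (u x : ℂ) * F x := fun F =>
    integrable_of_continuous (by fun_prop)
  let L : C(Torus d, ℂ) →ₗ[ℂ] ℂ :=
    { toFun := fun F => ∫ x, (u x : ℂ) * F x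
      map_add' := fun F G => by
        simp only [ContinuousMap.add_apply, mul_add]
        exact integral_add (hint F) (hint G)
      map_smul' := fun c F => by
        simp only [ContinuousMap.smul_apply, smul_eq_mul, RingHom.id_apply]
        rw [← integral_const_mul]
        congr 1 with x
        ring }
  have hL : Continuous L := by
    refine (L.mkContinuous (∫ x, |u x|) fun F => ?_).continuous
    rw [← integral_mul_const]
    refine norm_integral_le_of_norm_le
      ((integrable_of_continuous hu.abs).mul_const _) (Eventually.of_forall fun x => ?_)
    rw [norm_mul, Complex.norm_real, Real.norm_eq_abs]
    gcongr
    exact F.norm_coe_le_norm x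
  -- The characters span a dense subspace, so the continuous functional `L` vanishes identically;
  -- applied to `u` itself it gives `∫ u² = 0`.
  have hker : (⊤ : Submodule ℂ C(Torus d, ℂ)) ≤ LinearMap.ker L := by
    rw [← span_mFourier_closure_eq_top]
    refine Submodule.topologicalClosure_minimal _ (Submodule.span_le.2 ?_)
      (isClosed_singleton.preimage hL)
    rintro _ ⟨n, rfl⟩
    exact h n
  have h1 : ∫ x, (u x : ℂ) * (u x : ℂ) = 0 :=
    hker (Submodule.mem_top (x := (⟨fun x => (u x : ℂ), by fun_prop⟩ : C(Torus d, ℂ))))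
  have h2 : ∫ x, u x * u x = 0 := by
    simp only [← Complex.ofReal_mul] at h1
    rw [integral_complex_ofReal] at h1
    exact_mod_cast h1
  rw [integral_eq_zero_iff_of_nonneg (fun x => mul_self_nonneg (u x))
    (integrable_of_continuous (hu.mul hu))] at h2
  refine (Continuous.ae_eq_iff_eq volume hu continuous_zero).1 (h2.mono fun x hx => ?_)
  simpa using hx

/-- Translation is continuous in `L^s` for finite `s`, and pairing with a fixed element of the dual
space is continuous. -/
theorem continuous_integral_inner_translate {s : ℝ} (hs : 1 < s) {w g : Torus d → Vec d}
    (hw : MemLp w (ENNReal.ofReal (Real.conjExponent s)) volume)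
    (hg : MemLp g (ENNReal.ofReal s) volume) :
    Continuous fun h : Torus d => ∫ x, inner ℝ (w x) (g (x + h)) := by
  have hconj := (Real.HolderConjugate.conjExponent hs).symm
  have hconj' : (ENNReal.ofReal (Real.conjExponent s)).HolderConjugate (ENNReal.ofReal s) :=
    hconj.ennrealOfReal
  have : Fact (1 ≤ ENNReal.ofReal s) := ⟨by simpa using hs.le⟩
  have : Fact (1 ≤ ENNReal.ofReal (Real.conjExponent s)) := ⟨by simpa using hconj.lt.le⟩
  have hτ : Continuous fun h : Torus d => (⟨fun x => x + h, by fun_prop⟩ : C(Torus d, Torus d)) :=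
    ContinuousMap.continuous_of_continuous_uncurry _ (by
      simp only [Function.uncurry_def, ContinuousMap.coe_mk]; fun_prop)
  have h1 := Continuous.compMeasurePreservingLp (f := fun _ : Torus d => hg.toLp g)
    continuous_const hτ (fun h => measurePreserving_add_right volume h) ENNReal.ofReal_ne_top
  let B : Vec d →L[ℝ] Vec d →L[ℝ] ℝ :=
    (isBoundedBilinearMap_inner (𝕜 := ℝ) (E := Vec d)).toContinuousLinearMap
  have h2 := (B.lpPairing volume (ENNReal.ofReal (Real.conjExponent s)) (ENNReal.ofReal s)
    (hw.toLp w)).continuous.comp h1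
  refine h2.congr fun h => ?_
  simp only [Function.comp_apply]
  rw [ContinuousLinearMap.lpPairing_eq_integral, Lp.toLp_compMeasurePreserving]
  refine integral_congr_ae ?_
  filter_upwards [hw.coeFn_toLp, (hg.comp_measurePreserving
    (measurePreserving_add_right volume h)).coeFn_toLp] with x hx hx'
  rw [hx]
  change inner ℝ (w x) _ = _
  congr 1

/-- The Fourier coefficient of a correlation is a product of Fourier coefficients: those of `g` are
parallel to `N`, and those of `w` are orthogonal to `N`. The hypothesis `hF` abstracts the
subtraction formulas for cosine and sine, so one statement serves both. -/
theorem integral_mul_integral_inner_translate_eq_zero {w g : Torus d → Vec d}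
    (hw : Integrable w) (hg : Integrable g) {F R S a b : Torus d → ℝ} (hFc : Continuous F)
    (hR : Continuous R) (hS : Continuous S)
    (ha : Continuous a) (hb : Continuous b) (hF : ∀ x y, F (y - x) = R y * a x + S y * b x)
    {N : Vec d} {A B : ℝ} (hA : ∫ y, R y • g y = A • N) (hB : ∫ y, S y • g y = B • N)
    (ha0 : ∫ x, a x * inner ℝ (w x) N = 0) (hb0 : ∫ x, b x * inner ℝ (w x) N = 0) :
    ∫ h, F h * ∫ x, inner ℝ (w x) (g (x + h)) = 0 := by
  have hbdd : ∀ {u : Torus d → ℝ}, Continuous u → ∃ C, ∀ x, ‖u x‖ ≤ C := fun hu => by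
    obtain ⟨C, hC⟩ := (isCompact_range hu.norm).bddAbove
    exact ⟨C, fun x => hC (mem_range_self x)⟩
  have i0 : Integrable (fun z : Torus d × Torus d => inner ℝ (w z.1) (g z.2))
      (volume.prod volume) := by
    refine (hw.norm.mul_prod hg.norm).mono' (hw.1.comp_fst.inner hg.1.comp_snd)
      (Eventually.of_forall fun z => norm_inner_le_norm _ _)
  have i1 : Integrable (fun z : Torus d × Torus d => inner ℝ (w z.1) (g (z.1 + z.2)))
      (volume.prod volume) :=
    (measurePreserving_prod_add volume volume).integrable_comp_of_integrable i0
  have i2 : Integrable (fun z : Torus d × Torus d => F z.2 * inner ℝ (w z.1) (g (z.1 + z.2)))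
      (volume.prod volume) := by
    obtain ⟨C, hC⟩ := hbdd hFc
    exact i1.bdd_mul (c := C) (hFc.comp continuous_snd).aestronglyMeasurable
      (Eventually.of_forall fun z => hC z.2)
  have ig : ∀ {u : Torus d → ℝ}, Continuous u → Integrable fun y => u y • g y := fun hu => by
    obtain ⟨C, hC⟩ := hbdd hu
    exact hg.bdd_smul C hu.aestronglyMeasurable (Eventually.of_forall hC)
  have iw : ∀ {u : Torus d → ℝ}, Continuous u → Integrable fun x => u x * inner ℝ (w x) N :=
    fun hu => by
      obtain ⟨C, hC⟩ := hbdd hu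
      exact (hw.inner_const N).bdd_mul (c := C) hu.aestronglyMeasurable (Eventually.of_forall hC)
  have key : ∀ x, ∫ h, F h * inner ℝ (w x) (g (x + h)) =
      A * (a x * inner ℝ (w x) N) + B * (b x * inner ℝ (w x) N) := by
    intro x
    have h1 := integral_add_left_eq_self (μ := (volume : Measure (Torus d)))
      (fun y => F (y - x) * inner ℝ (w x) (g y)) x
    simp only [add_sub_cancel_left] at h1
    rw [h1]
    have h2 : ∀ y, F (y - x) * inner ℝ (w x) (g y) =
        a x * inner ℝ (w x) (R y • g y) + b x * inner ℝ (w x) (S y • g y) := fun y => by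
      rw [hF, inner_smul_right, inner_smul_right]; ring
    simp only [h2]
    rw [integral_add (((ig hR).const_inner (w x)).const_mul _)
      (((ig hS).const_inner (w x)).const_mul _), integral_const_mul, integral_const_mul,
      integral_inner (ig hR), integral_inner (ig hS), hA, hB, inner_smul_right, inner_smul_right]
    ring
  calc ∫ h, F h * ∫ x, inner ℝ (w x) (g (x + h))
      = ∫ h, ∫ x, F h * inner ℝ (w x) (g (x + h)) := by
        congr 1 with h
        rw [integral_const_mul]
    _ = ∫ x, ∫ h, F h * inner ℝ (w x) (g (x + h)) := (integral_integral_swap i2).symm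
    _ = 0 := by
        simp only [key]
        rw [integral_add ((iw ha).const_mul A) ((iw hb).const_mul B), integral_const_mul,
          integral_const_mul, ha0, hb0]
        ring

/-- For real and imaginary parts of characters, this says that the Fourier coefficients of a weak
gradient are parallel to the frequency. -/
theorem HasSobolevGrad.integral_smul {p : ENNReal} (hp : 1 ≤ p) {φ : Torus d → ℝ}
    {g : Torus d → Vec d} (h : HasSobolevGrad p φ g) {ψ : Torus d → ℝ} (hψ : SmoothOnTorus ψ)
    {θ : Torus d → ℝ} {N : Vec d} (hθ : ∀ x, torusGrad ψ x = θ x • N) :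
    ∫ x, ψ x • g x = (-∫ x, φ x * θ x) • N := by
  obtain ⟨C, hC⟩ := (isCompact_range hψ.continuous.norm).bddAbove
  have ig : Integrable fun x => ψ x • g x :=
    (h.memLp_grad.integrable hp).bdd_smul C hψ.continuous.aestronglyMeasurable
      (Eventually.of_forall fun x => hC (mem_range_self x))
  ext i
  have h1 := (EuclideanSpace.proj (𝕜 := ℝ) i : Vec d →L[ℝ] ℝ).integral_comp_comm ig
  have h2 := h.integral_by_parts ψ hψ i
  simp only [hθ, PiLp.smul_apply, smul_eq_mul] at h2
  simp only [PiLp.proj_apply, PiLp.smul_apply, smul_eq_mul] at h1 ⊢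
  rw [← h1]
  have h3 : ∫ x, ψ x * g x i = ∫ x, g x i * ψ x := by simp only [mul_comm]
  have h4 : ∫ x, φ x * (θ x * N i) = (∫ x, φ x * θ x) * N i := by
    rw [← integral_mul_const]; simp only [mul_assoc]
  linarith

/-- Divergence-free fields in the dual Lebesgue space may be tested against weak gradients. -/
theorem integral_inner_weakGrad_eq_zero {s : ℝ} (hs : 1 < s) {w g : Torus d → Vec d}
    {φ : Torus d → ℝ} (hw : MemLp w (ENNReal.ofReal (Real.conjExponent s)) volume)
    (hφg : HasSobolevGrad (ENNReal.ofReal s) φ g) (hdiv : DivFree w) :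
    ∫ x, inner ℝ (w x) (g x) = 0 := by
  have hs1 : 1 ≤ ENNReal.ofReal s := by simpa using hs.le
  have hconj : 1 ≤ ENNReal.ofReal (Real.conjExponent s) := by
    simpa using (Real.HolderConjugate.conjExponent hs).symm.lt.le
  have hu := continuous_integral_inner_translate hs hw hφg.memLp_grad
  have hwi := hw.integrable hconj
  have hgi := hφg.memLp_grad.integrable hs1
  -- The correlation of `w` and `g` is continuous with vanishing Fourier coefficients, hence zero
  -- everywhere. Continuity is what makes its value at `h = 0`, the desired integral, accessible.
  have h0 : (fun h : Torus d => ∫ x, inner ℝ (w x) (g (x + h))) = 0 := by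
    refine eq_zero_of_integral_mFourier_eq_zero hu fun n => ?_
    have hRs := smoothOnTorus_mFourier_re n
    have hSs := smoothOnTorus_mFourier_im n
    have hA := hφg.integral_smul hs1 hRs (torusGrad_mFourier_re n)
    have hB := hφg.integral_smul hs1 hSs (torusGrad_mFourier_im n)
    have hS0 : ∫ x, (mFourier n x).im * inner ℝ (w x) (frequency n) = 0 := by
      have := hdiv _ hRs
      simpa only [torusGrad_mFourier_re, inner_smul_right, neg_mul, integral_neg, neg_eq_zero]
        using this
    have hR0 : ∫ x, (mFourier n x).re * inner ℝ (w x) (frequency n) = 0 := by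
      have := hdiv _ hSs
      simpa only [torusGrad_mFourier_im, inner_smul_right] using this
    have h1 := integral_mul_integral_inner_translate_eq_zero hwi hgi hRs.continuous hRs.continuous
      hSs.continuous hRs.continuous hSs.continuous
      (fun x y => by rw [mFourier_sub]; simp [Complex.mul_re]) hA hB hR0 hS0
    have h2 := integral_mul_integral_inner_translate_eq_zero hwi hgi hSs.continuous hRs.continuous
      hSs.continuous hSs.continuous.neg hRs.continuous
      (fun x y => by rw [mFourier_sub]; simp [Complex.mul_im]) hA hB
      (by simpa only [Pi.neg_apply, neg_mul, integral_neg, neg_eq_zero] using hS0) hR0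
    have h3 : ∀ h : Torus d, ((∫ x, inner ℝ (w x) (g (x + h)) : ℝ) : ℂ) * mFourier n h =
        (((mFourier n h).re * ∫ x, inner ℝ (w x) (g (x + h)) : ℝ) : ℂ) +
        (((mFourier n h).im * ∫ x, inner ℝ (w x) (g (x + h)) : ℝ) : ℂ) * Complex.I := fun h => by
      conv_lhs => rw [← Complex.re_add_im (mFourier n h)]
      push_cast
      ring
    simp only [h3]
    rw [integral_add, integral_mul_const, integral_complex_ofReal, integral_complex_ofReal, h1, h2]
    · simp
    · exact (integrable_of_continuous (hRs.continuous.mul hu)).ofReal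
    · exact (integrable_of_continuous (hSs.continuous.mul hu)).ofReal.mul_const _
  have := congrFun h0 0
  simpa using this

end Fourier

/-! ### Uniqueness by monotonicity -/

section Uniqueness

variable {d : ℕ} {H : Torus d → Vec d → ℝ} {f : Torus d → ℝ → ℝ} {q r : ℝ}

/-- A weak solution has density `couplingInv f x (lam + H x (g x))`. -/
theorem IsWeakSolution.exists_grad (hf : CouplingCond f q) (hq : 1 < q) {lam : ℝ}
    {φ m : Torus d → ℝ} (h : IsWeakSolution H f q r lam φ m) :
    ∃ g, HasSobolevGrad (ENNReal.ofReal (q / (q - 1) * r)) φ g ∧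
      (m =ᵐ[volume] fun x => couplingInv f x (lam + H x (g x))) ∧
      ∫ x, couplingInv f x (lam + H x (g x)) = 1 ∧
      DivFree (fun x => couplingInv f x (lam + H x (g x)) • DpH H x (g x)) := by
  obtain ⟨g, hφg, -, hm0, hm1, -, heq, hle, hdiv⟩ := h
  have hm : m =ᵐ[volume] fun x => couplingInv f x (lam + H x (g x)) := by
    filter_upwards [hm0, heq, hle] with x h0 h1 h2
    exact hf.eq_couplingInv hq h0 h1 h2
  refine ⟨g, hφg, hm, (integral_congr_ae hm).symm.trans hm1, fun ψ hψ => ?_⟩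
  refine (integral_congr_ae ?_).trans (hdiv ψ hψ)
  filter_upwards [hm] with x hx
  rw [hx]

/-- The convexity inequality for the density of a critical point, tested against another pair. -/
theorem sub_le_integral_couplingInv_mul (hH : HamiltonianCond H r) (hr : 1 < r)
    (hf : CouplingCond f q) (hq : 1 < q) {l₁ l₂ : ℝ} {φ₁ φ₂ : Torus d → ℝ}
    {g₁ g₂ : Torus d → Vec d}
    (h₁ : HasSobolevGrad (ENNReal.ofReal (q / (q - 1) * r)) φ₁ g₁)
    (h₂ : HasSobolevGrad (ENNReal.ofReal (q / (q - 1) * r)) φ₂ g₂)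
    (hmass : ∫ x, couplingInv f x (l₁ + H x (g₁ x)) = 1)
    (hdiv : DivFree (fun x => couplingInv f x (l₁ + H x (g₁ x)) • DpH H x (g₁ x)))
    (hint : Integrable fun x => couplingInv f x (l₁ + H x (g₁ x)) *
      ((l₂ + H x (g₂ x)) - (l₁ + H x (g₁ x)))) :
    l₂ - l₁ ≤ ∫ x, couplingInv f x (l₁ + H x (g₁ x)) *
      ((l₂ + H x (g₂ x)) - (l₁ + H x (g₁ x))) := by
  have hs := one_lt_exponent hq hr
  set M : Torus d → ℝ := fun x => couplingInv f x (l₁ + H x (g₁ x)) with hM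
  have hw := memLp_couplingInv_smul_DpH hH hr hf hq l₁ h₁.memLp_grad
  have : (ENNReal.ofReal (Real.conjExponent (q / (q - 1) * r))).HolderConjugate
      (ENNReal.ofReal (q / (q - 1) * r)) :=
    (Real.HolderConjugate.conjExponent hs).symm.ennrealOfReal
  have iinner : ∀ {g : Torus d → Vec d}, MemLp g (ENNReal.ofReal (q / (q - 1) * r)) volume →
      Integrable fun x => inner ℝ (M x • DpH H x (g₁ x)) (g x) := fun {g} hg =>
    (hw.norm.integrable_mul hg.norm).mono' (hw.1.inner hg.1)
      (Eventually.of_forall fun x => norm_inner_le_norm _ _)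
  have iM : Integrable M := (memLp_couplingInv hH hr hf hq l₁ h₁.memLp_grad).integrable
    (by simpa using hq.le)
  have z₁ := integral_inner_weakGrad_eq_zero hs hw h₁ hdiv
  have z₂ := integral_inner_weakGrad_eq_zero hs hw h₂ hdiv
  have isub : Integrable fun x => inner ℝ (M x • DpH H x (g₁ x)) (g₂ x) -
      inner ℝ (M x • DpH H x (g₁ x)) (g₁ x) := (iinner h₂.memLp_grad).sub (iinner h₁.memLp_grad)
  have e : ∫ x, (M x * (l₂ - l₁) + (inner ℝ (M x • DpH H x (g₁ x)) (g₂ x) -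
      inner ℝ (M x • DpH H x (g₁ x)) (g₁ x))) = l₂ - l₁ := by
    rw [integral_add (iM.mul_const _) isub,
      integral_sub (iinner h₂.memLp_grad) (iinner h₁.memLp_grad), integral_mul_const, z₁, z₂,
      hmass]
    ring
  rw [← e]
  refine integral_mono ((iM.mul_const _).add isub) hint fun x => ?_
  have h3 := mul_le_mul_of_nonneg_left (hH.add_inner_le x (g₁ x) (g₂ x))
    (hf.couplingInv_nonneg hq x (l₁ + H x (g₁ x)))
  simp only [hM, real_inner_smul_left]
  rw [inner_sub_right] at h3
  linarith

/-- The two inequalities from `sub_le_integral_couplingInv_mul` have left-hand sides adding to zero,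
while monotonicity makes the sum of the right-hand sides at most zero. Hence the monotonicity
integrand vanishes a.e. -/
theorem IsWeakSolution.unique (hH : HamiltonianCond H r) (hr : 1 < r)
    (hf : CouplingCond f q) (hq : 1 < q) {l₁ l₂ : ℝ} {φ₁ m₁ φ₂ m₂ : Torus d → ℝ}
    (h₁ : IsWeakSolution H f q r l₁ φ₁ m₁) (h₂ : IsWeakSolution H f q r l₂ φ₂ m₂) :
    l₁ = l₂ ∧ m₁ =ᵐ[volume] m₂ := by
  obtain ⟨g₁, hg₁, hm₁, hmass₁, hdiv₁⟩ := h₁.exists_grad hf hq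
  obtain ⟨g₂, hg₂, hm₂, hmass₂, hdiv₂⟩ := h₂.exists_grad hf hq
  have hs := one_lt_exponent hq hr
  have hconj : (ENNReal.ofReal q).HolderConjugate (ENNReal.ofReal (q / (q - 1))) :=
    (Real.HolderConjugate.conjExponent hq).ennrealOfReal
  have hHp : ∀ (l : ℝ) {g : Torus d → Vec d},
      MemLp g (ENNReal.ofReal (q / (q - 1) * r)) volume →
      MemLp (fun x => l + H x (g x)) (ENNReal.ofReal (q / (q - 1))) volume := by
    intro l g hg
    obtain ⟨C, hC, h⟩ := hH.exists_abs_le hr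
    have h1 := memLp_of_norm_le_rpow (b := r) (K := C) (by linarith) hg
      (hH.continuous.comp_aestronglyMeasurable (aestronglyMeasurable_id.prodMk hg.1))
      fun x => h x (g x)
    rw [mul_div_assoc, div_self (by linarith), mul_one] at h1
    exact MemLp.add (f := fun _ => l) (memLp_const l) h1
  have hM₁ := memLp_couplingInv hH hr hf hq l₁ hg₁.memLp_grad
  have hM₂ := memLp_couplingInv hH hr hf hq l₂ hg₂.memLp_grad
  have ha₁ := hHp l₁ hg₁.memLp_grad
  have ha₂ := hHp l₂ hg₂.memLp_grad
  have i₁ : Integrable fun x => couplingInv f x (l₁ + H x (g₁ x)) *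
      ((l₂ + H x (g₂ x)) - (l₁ + H x (g₁ x))) := hM₁.integrable_mul (ha₂.sub ha₁)
  have i₂ : Integrable fun x => couplingInv f x (l₂ + H x (g₂ x)) *
      ((l₁ + H x (g₁ x)) - (l₂ + H x (g₂ x))) := hM₂.integrable_mul (ha₁.sub ha₂)
  have k₁ := sub_le_integral_couplingInv_mul hH hr hf hq hg₁ hg₂ hmass₁ hdiv₁ i₁
  have k₂ := sub_le_integral_couplingInv_mul hH hr hf hq hg₂ hg₁ hmass₂ hdiv₂ i₂
  -- monotonicity
  have hmono : ∀ x, 0 ≤ -(couplingInv f x (l₁ + H x (g₁ x)) *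
        ((l₂ + H x (g₂ x)) - (l₁ + H x (g₁ x))) + couplingInv f x (l₂ + H x (g₂ x)) *
        ((l₁ + H x (g₁ x)) - (l₂ + H x (g₂ x)))) := fun x => by
    rcases le_total (l₁ + H x (g₁ x)) (l₂ + H x (g₂ x)) with h | h
    · nlinarith [mul_nonneg (sub_nonneg.2 (hf.couplingInv_mono hq x h)) (sub_nonneg.2 h)]
    · nlinarith [mul_nonneg (sub_nonneg.2 (hf.couplingInv_mono hq x h)) (sub_nonneg.2 h)]
  have hint0 : 0 ≤ ∫ x, -(couplingInv f x (l₁ + H x (g₁ x)) *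
        ((l₂ + H x (g₂ x)) - (l₁ + H x (g₁ x))) + couplingInv f x (l₂ + H x (g₂ x)) *
        ((l₁ + H x (g₁ x)) - (l₂ + H x (g₂ x)))) := integral_nonneg hmono
  have hsum := hint0
  rw [integral_neg, integral_add i₁ i₂] at hsum
  have hzero : ∫ x, -(couplingInv f x (l₁ + H x (g₁ x)) *
        ((l₂ + H x (g₂ x)) - (l₁ + H x (g₁ x))) + couplingInv f x (l₂ + H x (g₂ x)) *
        ((l₁ + H x (g₁ x)) - (l₂ + H x (g₂ x)))) = 0 := by
    refine le_antisymm ?_ hint0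
    rw [integral_neg, integral_add i₁ i₂]
    linarith
  rw [integral_eq_zero_iff_of_nonneg (fun x => hmono x) (i₁.add i₂).neg] at hzero
  have hM : ∀ᵐ x, couplingInv f x (l₁ + H x (g₁ x)) = couplingInv f x (l₂ + H x (g₂ x)) ∧
      couplingInv f x (l₁ + H x (g₁ x)) * ((l₂ + H x (g₂ x)) - (l₁ + H x (g₁ x))) = 0 := by
    filter_upwards [hzero] with x hx
    simp only [Pi.zero_apply] at hx
    have hx' : (couplingInv f x (l₁ + H x (g₁ x)) - couplingInv f x (l₂ + H x (g₂ x))) *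
        ((l₂ + H x (g₂ x)) - (l₁ + H x (g₁ x))) = 0 := by linarith
    have heq : couplingInv f x (l₁ + H x (g₁ x)) = couplingInv f x (l₂ + H x (g₂ x)) := by
      rcases mul_eq_zero.1 hx' with h | h
      · exact sub_eq_zero.1 h
      · rw [sub_eq_zero.1 h]
    refine ⟨heq, ?_⟩
    -- Where the common density is positive, applying `f x` recovers both arguments, which therefore
    -- agree; where it is zero, the product vanishes anyway.
    rcases (hf.couplingInv_nonneg hq x (l₁ + H x (g₁ x))).eq_or_lt with h | h
    · rw [← h, zero_mul]
    · have e₁ := hf.apply_couplingInv hq h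
      have e₂ := hf.apply_couplingInv hq (heq ▸ h)
      rw [← heq, e₁] at e₂
      rw [e₂, sub_self, mul_zero]
  have z₁ : ∫ x, couplingInv f x (l₁ + H x (g₁ x)) *
      ((l₂ + H x (g₂ x)) - (l₁ + H x (g₁ x))) = 0 :=
    integral_eq_zero_of_ae (hM.mono fun x hx => hx.2)
  refine ⟨by linarith, ?_⟩
  filter_upwards [hm₁, hm₂, hM] with x hx₁ hx₂ hx
  rw [hx₁, hx₂, hx.1]

end Uniqueness

end ErgodicMFG

theorem theorem4p2 (d : ℕ) (q r : ℝ) (hq : 1 < q) (hr : max ((d : ℝ) * (q - 1)) 1 < r)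
    (H : ErgodicMFG.Torus d → ErgodicMFG.Vec d → ℝ) (hH : ErgodicMFG.HamiltonianCond H r)
    (f : ErgodicMFG.Torus d → ℝ → ℝ) (hf : ErgodicMFG.CouplingCond f q) :
    (∃ (lam : ℝ) (φ m : ErgodicMFG.Torus d → ℝ),
      ErgodicMFG.IsWeakSolution H f q r lam φ m) ∧
    (∀ (lam₁ lam₂ : ℝ) (φ₁ m₁ φ₂ m₂ : ErgodicMFG.Torus d → ℝ),
      ErgodicMFG.IsWeakSolution H f q r lam₁ φ₁ m₁ →
      ErgodicMFG.IsWeakSolution H f q r lam₂ φ₂ m₂ →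
      lam₁ = lam₂ ∧ m₁ =ᵐ[MeasureTheory.volume] m₂) := by
  have hr1 : 1 < r := (le_max_right _ _).trans_lt hr
  exact ⟨ErgodicMFG.exists_isWeakSolution hH hr1 hf hq,
    fun _ _ _ _ _ _ h₁ h₂ => h₁.unique hH hr1 hf hq h₂⟩
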